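/- Let $\Gamma$ be a finitely generated group that is virtually $(\mathcal H,F)$-indicable: $\mathcal H\trianglelefteq\Gamma$ is a normal subgroup of finite index and $F:\mathcal H\to\mathbb Z$ is a surjective homomorphism. *Walks and weights.* A self-avoiding walk (SAW) is a finite sequence $\pi=(\pi_0,\dots,\pi_n)$, $n\ge 0$, of distinct elements of $\Gamma$. For $\phi:\Gamma\to[0,\infty)$ put $w_\phi(\pi)=\prod_{i=1}^n\phi(\pi_{i-1}^{-1}\pi_i)$, and $w_\phi(\Pi)=\sum_{\pi\in\Pi}w_\phi(\pi)$ for a set $\Pi$ of SAWs. Let $\Phi$ be the set of $\phi:\Gamma\to[0,\infty)$ that are symmetric ($\phi(\gamma^{-1})=\phi(\gamma)$), summable ($\sum_{\gamma}\phi(\gamma)<\infty$) and spanning (any two elements of $\Gamma$ are joined by a SAW of strictly positive weight). For $\phi\in\Phi$ let $K_\phi$ be the graph on $\Gamma$ in which distinct $u,v$ are adjacent if and only if $\phi(u^{-1}v)>0$. *Heights.* A strong graph height function $(h,\mathcal H)$ on $K_\phi$ is a function $h:\Gamma\to\mathbb Z$ with $h(\mathbf 1)=0$, with $h(\alpha v)-h(\alpha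 u)=h(v)-h(u)$ for all $\alpha\in\mathcal H$ and $u,v\in\Gamma$, and such that every $v\in\Gamma$ has neighbours $u,w$ in $K_\phi$ with $h(u)<h(v)<h(w)$. A SAW $\pi$ is a bridge if $h(\pi_0)<h(\pi_i)\le h(\pi_n)$ for $1\le i\le n$. *Lengths.* Let $\Lambda$ be the set of $\ell:\Gamma\to(0,\infty)$ with $\ell(\gamma^{-1})=\ell(\gamma)$ for all $\gamma$ and $\inf_\gamma\ell(\gamma)>0$, and put $\ell(\pi)=\sum_{i=1}^n\ell(\pi_{i-1}^{-1}\pi_i)$. For $C>0$ and $\varepsilon\in[1,2)$, let $\Lambda_\varepsilon(C,\phi)$ be the set of $\ell\in\Lambda$ such that $|h(u)-h(v)|\le C\,\ell(u^{-1}v)^{\varepsilon}$ for all $u,v\in\Gamma$ with $\phi(u^{-1}v)>0$. Let $\sigma_{m,c}$ be the set of SAWs $\pi$ from $\mathbf 1$ with $m\le\ell(\pi)<m+c$, and $\beta_{m,c}(v)$ the set of bridges $\pi$ from $v$ with $m\le\ell(\pi)<m+c$. *Constants.* The connective constant $\mu_{\phi,\ell}$ is the common value, for all sufficiently large $c$,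 of $\limsup_{m\to\infty}w_\phi(\sigma_{m,c})^{1/m}$. The bridge constant $\beta_{\phi,\ell}$ is the common value, for all sufficiently large $c$ and all $v\in\Gamma$, of $\lim_{m\to\infty}w_\phi(\beta_{m,c}(v))^{1/m}$. **Theorem.** Let $\phi\in\Phi$, let $(h,\mathcal H)$ be a strong graph height function on $K_\phi$, and let $\ell\in\Lambda_\varepsilon(C,\phi)$ for some $\varepsilon\in[1,2)$ and $C>0$. Then the constants $\mu_{\phi,\ell}$ and $\beta_{\phi,\ell}$ exist, $0<\mu_{\phi,\ell}<\infty$, and the following hold. (a) $\mu_{\phi,\ell}=\beta_{\phi,\ell}$, and for all sufficiently large $c$, $\lim_{m\to\infty}w_\phi(\sigma_{m,c})^{1/m}=\mu_{\phi,\ell}$. (b) If $\nu\in\Phi$ and $\nu\le\phi$, then $\ell\in\Lambda_\varepsilon(C,\nu)$, the constant $\mu_{\nu,\ell}$ exists, and $\mu_{\nu,\ell}\le\mu_{\phi,\ell}$. -/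

import Mathlib

open Filter Topology
open scoped NNReal ENNReal

noncomputable section

namespace WeightedSAW

variable {Γ : Type*} [Group Γ]

/-- The self-avoiding walks from `v`, of any finite number of steps, on the complete graph with
vertex set `Γ`: an endpoint together with a walk from `v` to it that repeats no vertex. -/
abbrev SAW (v : Γ) : Type _ := Σ u : Γ, (⊤ : SimpleGraph Γ).Path v u

/-- The weight of a walk: the product of `φ (u⁻¹ * v)` over the steps `(u, v)`. -/
def walkWeight (φ : Γ → ℝ≥0) {v u : Γ} (p : (⊤ : SimpleGraph Γ).Walk v u) : ℝ≥0 :=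
  (p.darts.map fun d => φ (d.fst⁻¹ * d.snd)).prod

/-- The `ℓ`-length of a walk: the sum of `ℓ (u⁻¹ * v)` over the steps `(u, v)`. -/
def walkLength (ℓ : Γ → ℝ) {v u : Γ} (p : (⊤ : SimpleGraph Γ).Walk v u) : ℝ :=
  (p.darts.map fun d => ℓ (d.fst⁻¹ * d.snd)).sum

/-- The total weight of a set of self-avoiding walks, as an unconditional sum in `[0, ∞]`. -/
def totalWeight (φ : Γ → ℝ≥0) {v : Γ} (P : Set (SAW v)) : ℝ≥0∞ :=
  ∑' π : P, (walkWeight φ (π : SAW v).2.1 : ℝ≥0∞)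

/-- A walk is a bridge if every vertex after the first is strictly higher than the first and no
higher than the last. -/
def IsBridge (h : Γ → ℤ) {v u : Γ} (p : (⊤ : SimpleGraph Γ).Walk v u) : Prop :=
  ∀ x ∈ p.support.tail, h v < h x ∧ h x ≤ h u

/-- Self-avoiding walks from `v` with `ℓ`-length in `[m, m + c)`. -/
def sawSet (ℓ : Γ → ℝ) (m c : ℝ) (v : Γ) : Set (SAW v) :=
  {π | m ≤ walkLength ℓ π.2.1 ∧ walkLength ℓ π.2.1 < m + c}

/-- Bridges from `v` with `ℓ`-length in `[m, m + c)`. -/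
def bridgeSet (h : Γ → ℤ) (ℓ : Γ → ℝ) (m c : ℝ) (v : Γ) : Set (SAW v) :=
  {π | IsBridge h π.2.1 ∧ m ≤ walkLength ℓ π.2.1 ∧ walkLength ℓ π.2.1 < m + c}

/-- Weight functions: symmetric, summable, and spanning `Γ`, i.e. any two elements are joined by a
self-avoiding walk of strictly positive weight. -/
structure IsWeightFunction (φ : Γ → ℝ≥0) : Prop where
  symm : ∀ γ, φ γ⁻¹ = φ γ
  summable : Summable φ
  spans : ∀ η γ : Γ, ∃ π : (⊤ : SimpleGraph Γ).Path η γ, 0 < walkWeight φ π.1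

/-- Length functions: positive, symmetric, bounded away from `0`. -/
structure IsLengthFunction (ℓ : Γ → ℝ) : Prop where
  pos : ∀ γ, 0 < ℓ γ
  symm : ∀ γ, ℓ γ⁻¹ = ℓ γ
  lenMin_pos : 0 < ⨅ γ, ℓ γ

/-- The length functions satisfying the Hölder condition for the height function `h` along the
steps of positive `φ`-weight, with constant `C` and exponent `ε`. -/
structure IsHolderLength (h : Γ → ℤ) (φ : Γ → ℝ≥0) (C ε : ℝ) (ℓ : Γ → ℝ) : Prop
    extends IsLengthFunction ℓ where
  holder : ∀ u v : Γ, 0 < φ (u⁻¹ * v) → |(h u : ℝ) - (h v : ℝ)| ≤ C * ℓ (u⁻¹ * v) ^ ε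

/-- The Cayley graph of `Γ` whose generators are the support of `φ`: distinct `u`, `v` are adjacent
when `u⁻¹ * v` (or its inverse) lies in the support. -/
def supportGraph (φ : Γ → ℝ≥0) : SimpleGraph Γ := SimpleGraph.mulCayley {γ | 0 < φ γ}

/-- `Γ` is virtually `(H, F)`-indicable: `H` is a normal subgroup of finite index and `F` is a
surjective homomorphism from `H` to `ℤ`. -/
structure IsVirtuallyIndicable (H : Subgroup Γ) (F : H →* Multiplicative ℤ) : Prop where
  normal : H.Normal
  finiteIndex : H.FiniteIndex
  surjective : Function.Surjective F

/-- `(h, H)` is a strong graph height function on the Cayley graph `G` of `Γ`. The subgroup `H` acts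
by left multiplication, hence by automorphisms of a Cayley graph; its orbits are the right cosets of
`H`, so the action is quasi-transitive because the index is finite. -/
structure IsStrongHeightFunction (G : SimpleGraph Γ) (h : Γ → ℤ) (H : Subgroup Γ) : Prop where
  normal : H.Normal
  finiteIndex : H.FiniteIndex
  map_one : h 1 = 0
  diff_invariant : ∀ α ∈ H, ∀ u v : Γ, h (α * v) - h (α * u) = h v - h u
  exists_lower_upper : ∀ v : Γ, ∃ u w : Γ, G.Adj v u ∧ G.Adj v w ∧ h u < h v ∧ h v < h w

/-- `μ` is the weighted connective constant of `(φ, ℓ)`: for all sufficiently large `c`, the upper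
limit of `w_φ(σ_{m,c})^{1/m}` as `m → ∞` through the integers equals `μ`. At most one `μ` has this
property. -/
def IsConnectiveConstant (φ : Γ → ℝ≥0) (ℓ : Γ → ℝ) (μ : ℝ≥0∞) : Prop :=
  ∀ᶠ c : ℝ in atTop,
    limsup (fun m : ℕ => totalWeight φ (sawSet ℓ m c (1 : Γ)) ^ (1 / (m : ℝ))) atTop = μ

/-- `β` is the weighted bridge constant of `(φ, ℓ)` with respect to `h`: for all sufficiently large
`c` and every starting point `v`, `w_φ(β_{m,c}(v))^{1/m}` converges to `β` as `m → ∞`. At most one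
`β` has this property. -/
def IsBridgeConstant (h : Γ → ℤ) (φ : Γ → ℝ≥0) (ℓ : Γ → ℝ) (β : ℝ≥0∞) : Prop :=
  ∀ᶠ c : ℝ in atTop, ∀ v : Γ,
    Tendsto (fun m : ℕ => totalWeight φ (bridgeSet h ℓ m c v) ^ (1 / (m : ℝ))) atTop (𝓝 β)

end WeightedSAW

end

/-! A walk is encoded by its word of increments: weight becomes multiplicative and length additive
under concatenation, and walks from different vertices can be compared. Call a bridge from `1`
ending in `H` a loop bridge. Since `H` preserves height differences, loop bridges concatenate
freely. Tilt `φ` by `exp (-s ℓ)` and let `s*` be the infimum of the `s` at which the loop bridges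
have finite total weight. It is a real number (`finiteParams_nonempty`, `finiteParams_bddBelow`),
and both constants equal `exp s*`.

Upper bound: if the loop bridges are summable at `s`, so are all self-avoiding words
(`wordSum_saw_lt_top`), and windows at `m` weigh at most a constant times `exp (m s)`. This is the
Hammersley–Welsh decomposition in generating-function form: a half-space walk breaks at successive
extrema into alternately rising and falling bridges of strictly decreasing span, so its total weight
is at most `∏ (1 + E i)`, where `E i` bounds the bridges of span `i + 1`; the product is at most
`exp (∑ E i)`. A general walk is cut at its last minimum. Fixed connecting bridges reduce arbitrary
bridges to loop bridges.

Lower bound: if `s < s' < s*`, divergence at `s'` gives a block of loop bridges, with the same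
number of letters and the same integer part of length, that is as heavy at `s` as desired
(`exists_block`). Its `k`-fold products decode uniquely. Their lengths spread over an interval of
length `k`, and copies of one fixed loop bridge pad them into a prescribed window; the excess weight
of the block pays for the padding (`exists_le_wordSum_bridgeWords`).

Bridges are self-avoiding walks, so the two bounds squeeze both sequences. Part (b) follows from
monotonicity in the weight and from the independence of the limit superior from the window width
(`limsup_window_eq`). -/

noncomputable section

namespace WeightedSAW

/-! ### Words of increments -/

section Words

variable {Γ : Type*} [Group Γ]

/-- The vertices visited after `v` by the walk from `v` whose successive increments are the letters
of a word. -/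
def trail : Γ → List Γ → List Γ
  | _, [] => []
  | v, a :: l => (v * a) :: trail (v * a) l

/-- A word is self-avoiding if the walk with these increments repeats no vertex. -/
def IsSawWord (l : List Γ) : Prop := (1 :: trail 1 l).Nodup

/-- The increments of the reversed walk. -/
def revWord (l : List Γ) : List Γ := (l.map (·⁻¹)).reverse

@[simp] lemma trail_nil (v : Γ) : trail v [] = [] := rfl

@[simp] lemma trail_cons (v a : Γ) (l : List Γ) :
    trail v (a :: l) = (v * a) :: trail (v * a) l := rfl

lemma trail_append (v : Γ) (l l' : List Γ) :
    trail v (l ++ l') = trail v l ++ trail (v * l.prod) l' := by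
  induction l generalizing v with
  | nil => simp
  | cons a l ih => simp [ih, mul_assoc]

lemma trail_mul (α v : Γ) (l : List Γ) : trail (α * v) l = (trail v l).map (α * ·) := by
  induction l generalizing v with
  | nil => simp
  | cons a l ih => simp [← ih, mul_assoc]

lemma isSawWord_iff (v : Γ) (l : List Γ) : IsSawWord l ↔ (v :: trail v l).Nodup := by
  have : v :: trail v l = (1 :: trail 1 l).map (v * ·) := by
    rw [List.map_cons, ← trail_mul]; simp
  rw [this, List.nodup_map_iff (mul_right_injective v), IsSawWord]

lemma isSawWord_nil : IsSawWord ([] : List Γ) := by simp [IsSawWord]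

lemma isSawWord_append_iff (v : Γ) (l l' : List Γ) :
    IsSawWord (l ++ l') ↔ (v :: trail v l).Nodup ∧ (trail (v * l.prod) l').Nodup ∧
      ∀ a ∈ v :: trail v l, ∀ b ∈ trail (v * l.prod) l', a ≠ b := by
  rw [isSawWord_iff v, trail_append, ← List.cons_append, List.nodup_append]

lemma mul_prod_mem (v : Γ) (l : List Γ) : v * l.prod ∈ v :: trail v l := by
  induction l generalizing v with
  | nil => simp
  | cons a l ih =>
    have := ih (v * a)
    simp only [List.prod_cons, ← mul_assoc, trail_cons]
    exact List.mem_cons_of_mem _ this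

lemma mul_prod_mem_trail (v : Γ) {l : List Γ} (hl : l ≠ []) : v * l.prod ∈ trail v l := by
  cases l with
  | nil => exact absurd rfl hl
  | cons a l =>
    simp only [List.prod_cons, ← mul_assoc, trail_cons]
    exact mul_prod_mem _ _

lemma IsSawWord.left {l l' : List Γ} (hl : IsSawWord (l ++ l')) : IsSawWord l := by
  rw [isSawWord_iff 1]
  exact ((isSawWord_append_iff 1 l l').1 hl).1

lemma IsSawWord.right {l l' : List Γ} (hl : IsSawWord (l ++ l')) : IsSawWord l' := by
  have := (isSawWord_append_iff 1 l l').1 hl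
  rw [isSawWord_iff (1 * l.prod), List.nodup_cons]
  exact ⟨fun hm => this.2.2 _ (mul_prod_mem 1 l) _ hm rfl, this.2.1⟩

lemma revWord_cons (a : Γ) (l : List Γ) : revWord (a :: l) = revWord l ++ [a⁻¹] := by
  simp [revWord]

lemma revWord_prod (l : List Γ) : (revWord l).prod = l.prod⁻¹ := by
  simp [revWord, List.prod_inv_reverse]

lemma revWord_revWord (l : List Γ) : revWord (revWord l) = l := by
  simp [revWord, List.map_reverse]

lemma revWord_injective : Function.Injective (revWord : List Γ → List Γ) :=
  Function.LeftInverse.injective revWord_revWord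

lemma trail_revWord (v : Γ) (l : List Γ) :
    (v * l.prod) :: trail (v * l.prod) (revWord l) = (v :: trail v l).reverse := by
  induction l generalizing v with
  | nil => simp [revWord]
  | cons a l ih =>
    have := ih (v * a)
    rw [List.prod_cons, ← mul_assoc, revWord_cons, trail_append, ← List.cons_append, this,
      revWord_prod]
    simp

lemma IsSawWord.revWord {l : List Γ} (hl : IsSawWord l) : IsSawWord (revWord l) := by
  rw [isSawWord_iff (1 * l.prod), trail_revWord, List.nodup_reverse]
  exact hl

/-- Splitting a word at the last place where `f` is maximal along the walk. -/
lemma exists_split_last_max (f : Γ → ℤ) (v : Γ) (l : List Γ) :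
    ∃ l₁ l₂, l = l₁ ++ l₂ ∧ (∀ x ∈ v :: trail v l₁, f x ≤ f (v * l₁.prod)) ∧
      ∀ x ∈ trail (v * l₁.prod) l₂, f x < f (v * l₁.prod) := by
  induction l generalizing v with
  | nil => exact ⟨[], [], by simp⟩
  | cons a l ih =>
    obtain ⟨l₁, l₂, rfl, h₁, h₂⟩ := ih (v * a)
    -- On a tie the later maximum is kept, which makes the inequality after the cut strict.
    -- Otherwise `v` is the strict maximum and the first piece is empty.
    by_cases hv : f v ≤ f (v * a * l₁.prod)
    · refine ⟨a :: l₁, l₂, rfl, ?_, ?_⟩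
      · intro x hx
        rw [List.prod_cons, ← mul_assoc]
        rcases List.mem_cons.1 hx with rfl | hx
        · exact hv
        · exact h₁ x hx
      · rw [List.prod_cons, ← mul_assoc]
        exact h₂
    · refine ⟨[], a :: (l₁ ++ l₂), rfl, by simp, ?_⟩
      intro x hx
      simp only [List.prod_nil, mul_one] at hx ⊢
      rw [trail_cons, trail_append, ← List.cons_append, List.mem_append] at hx
      rcases hx with hx | hx
      · exact (h₁ x hx).trans_lt (not_le.1 hv)
      · exact (h₂ x hx).trans (not_le.1 hv)

/-- Loop erasure: a word can be replaced by a self-avoiding one with the same product, whose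
letters and whose visited vertices are among the original ones. -/
lemma exists_isSawWord_of_word (v : Γ) (l : List Γ) :
    ∃ l', IsSawWord l' ∧ l'.prod = l.prod ∧ (∀ a ∈ l', a ∈ l) ∧
      ∀ x ∈ trail v l', x ∈ trail v l := by
  induction l generalizing v with
  | nil => exact ⟨[], isSawWord_nil, rfl, by simp, by simp⟩
  | cons a l ih =>
    obtain ⟨k, hk, hp, hs, ht⟩ := ih (v * a)
    have hk' := (isSawWord_iff (v * a) k).1 hk
    -- If the erased tail returns to `v` after a prefix `k₁`, then `a :: k₁` is a closed loop and is
    -- discarded.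
    by_cases hv : v ∈ (v * a) :: trail (v * a) k
    · have : ∀ (k : List Γ) (u : Γ), v ∈ u :: trail u k →
          ∃ k₁ k₂, k = k₁ ++ k₂ ∧ u * k₁.prod = v := by
        intro k
        induction k with
        | nil => intro u hu; exact ⟨[], [], rfl, by simpa [eq_comm] using hu⟩
        | cons b k ihk =>
          intro u hu
          rcases List.mem_cons.1 hu with rfl | hu
          · exact ⟨[], b :: k, rfl, by simp⟩
          · obtain ⟨k₁, k₂, rfl, h⟩ := ihk (u * b) hu
            exact ⟨b :: k₁, k₂, rfl, by rw [List.prod_cons, ← mul_assoc, h]⟩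
      obtain ⟨k₁, k₂, rfl, hv'⟩ := this k _ hv
      refine ⟨k₂, hk.right, ?_, ?_, ?_⟩
      · rw [List.prod_cons, ← hp, List.prod_append]
        have : a * k₁.prod = 1 := by
          rw [mul_assoc] at hv'; exact mul_eq_left.1 hv'
        rw [← mul_assoc, this, one_mul]
      · intro b hb
        exact List.mem_cons_of_mem _ (hs b (List.mem_append_right _ hb))
      · intro x hx
        refine List.mem_cons_of_mem _ (ht x ?_)
        rw [trail_append, hv']
        exact List.mem_append_right _ hx
    · refine ⟨a :: k, ?_, by simp [hp], ?_, ?_⟩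
      · rw [isSawWord_iff v, trail_cons, List.nodup_cons]
        exact ⟨hv, hk'⟩
      · intro b hb
        rcases List.mem_cons.1 hb with rfl | hb
        · simp
        · exact List.mem_cons_of_mem _ (hs b hb)
      · intro x hx
        rw [trail_cons] at hx ⊢
        rcases List.mem_cons.1 hx with rfl | hx
        · simp
        · exact List.mem_cons_of_mem _ (ht x hx)

end Words

/-! ### Weighted sums over sets of words -/

section Sums

variable {Γ : Type*}

/-- The weight of a word: the product of the weights of its letters. -/
def wordWeight (ψ : Γ → ℝ≥0∞) (l : List Γ) : ℝ≥0∞ := (l.map ψ).prod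

/-- The total weight of a set of words. -/
def wordSum (ψ : Γ → ℝ≥0∞) (P : Set (List Γ)) : ℝ≥0∞ := ∑' l : P, wordWeight ψ l

variable (ψ : Γ → ℝ≥0∞)

@[simp] lemma wordWeight_nil : wordWeight ψ [] = 1 := rfl

@[simp] lemma wordWeight_cons (a : Γ) (l : List Γ) :
    wordWeight ψ (a :: l) = ψ a * wordWeight ψ l := by simp [wordWeight]

@[simp] lemma wordWeight_append (l l' : List Γ) :
    wordWeight ψ (l ++ l') = wordWeight ψ l * wordWeight ψ l' := by simp [wordWeight]

variable {ψ}

lemma wordWeight_ne_top (hψ : ∀ γ, ψ γ ≠ ⊤) (l : List Γ) : wordWeight ψ l ≠ ⊤ := by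
  induction l with
  | nil => simp
  | cons a l ih => rw [wordWeight_cons]; exact ENNReal.mul_ne_top (hψ a) ih

lemma wordWeight_ne_zero {l : List Γ} (hl : ∀ a ∈ l, ψ a ≠ 0) : wordWeight ψ l ≠ 0 := by
  rw [wordWeight, Ne, List.prod_eq_zero_iff, List.mem_map]
  rintro ⟨a, ha, h⟩
  exact hl a ha h

lemma wordWeight_revWord [Group Γ] (hψ : ∀ γ, ψ γ⁻¹ = ψ γ) (l : List Γ) :
    wordWeight ψ (revWord l) = wordWeight ψ l := by
  rw [wordWeight, revWord, List.map_reverse, List.prod_reverse, List.map_map]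
  simp only [Function.comp_def, hψ]
  rfl

lemma wordSum_mono {P Q : Set (List Γ)} (h : P ⊆ Q) : wordSum ψ P ≤ wordSum ψ Q :=
  ENNReal.tsum_mono_subtype (wordWeight ψ) h

lemma wordSum_union_le (P Q : Set (List Γ)) :
    wordSum ψ (P ∪ Q) ≤ wordSum ψ P + wordSum ψ Q :=
  ENNReal.tsum_union_le (wordWeight ψ) P Q

lemma wordSum_nil_le {P : Set (List Γ)} (h : ∀ l ∈ P, l = []) : wordSum ψ P ≤ 1 := by
  have : P ⊆ {[]} := fun l hl => h l hl
  refine (wordSum_mono this).trans ?_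
  rw [wordSum, tsum_singleton [] (wordWeight ψ)]
  simp

/-- A weighted sum is unchanged or increased by an injection that does not decrease weights. -/
lemma mul_wordSum_le_of_injOn {P Q : Set (List Γ)} (f : List Γ → List Γ) (hf : Set.InjOn f P)
    (hPQ : ∀ l ∈ P, f l ∈ Q) {K : ℝ≥0∞} (hK : ∀ l ∈ P, K * wordWeight ψ l ≤ wordWeight ψ (f l)) :
    K * wordSum ψ P ≤ wordSum ψ Q := by
  rw [wordSum, ← ENNReal.tsum_mul_left]
  refine (ENNReal.tsum_le_tsum fun l : P => hK l l.2).trans ?_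
  exact ENNReal.tsum_comp_le_tsum_of_injective
    (f := fun l : P => (⟨f l, hPQ l l.2⟩ : Q))
    (fun a b hab => Subtype.ext (hf a.2 b.2 (congrArg Subtype.val hab)))
    (fun l : Q => wordWeight ψ l)

/-- If every word of `P` splits as a word of `A` followed by a word of a set of total weight at
most `M`, then `P` has total weight at most that of `A` times `M`. -/
lemma wordSum_le_mul {P A : Set (List Γ)} (B : List Γ → Set (List Γ)) {M : ℝ≥0∞}
    (hP : ∀ l ∈ P, ∃ a ∈ A, ∃ b ∈ B a, l = a ++ b) (hM : ∀ a ∈ A, wordSum ψ (B a) ≤ M) :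
    wordSum ψ P ≤ wordSum ψ A * M := by
  let Q : Set (List Γ) := {l | ∃ a ∈ A, ∃ b ∈ B a, l = a ++ b}
  let f : (Σ a : A, B a) → Q := fun p => ⟨p.1 ++ p.2, p.1, p.1.2, p.2, p.2.2, rfl⟩
  have hf : Function.Surjective f := by
    rintro ⟨_, a, ha, b, hb, rfl⟩
    exact ⟨⟨⟨a, ha⟩, ⟨b, hb⟩⟩, rfl⟩
  calc wordSum ψ P ≤ wordSum ψ Q := wordSum_mono hP
    _ ≤ ∑' p : Σ a : A, B a, wordWeight ψ (p.1 ++ p.2) :=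
      ENNReal.tsum_le_tsum_comp_of_surjective hf fun l : Q => wordWeight ψ l
    _ = ∑' a : A, ∑' b : B a, wordWeight ψ (a ++ b) :=
      ENNReal.tsum_sigma fun (a : A) (b : B a) => wordWeight ψ (a ++ b)
    _ = ∑' a : A, wordWeight ψ a * wordSum ψ (B a) := by
      simp only [wordWeight_append, ENNReal.tsum_mul_left, wordSum]
    _ ≤ ∑' a : A, wordWeight ψ a * M := by
      gcongr with a; exact hM a a.2
    _ = wordSum ψ A * M := by rw [ENNReal.tsum_mul_right, wordSum]

/-- Concatenation of words of a fixed length with arbitrary words is injective. -/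
lemma mul_wordSum_le_of_length {P A B : Set (List Γ)} {n : ℕ} (hA : ∀ a ∈ A, a.length = n)
    (hP : ∀ a ∈ A, ∀ b ∈ B, a ++ b ∈ P) : wordSum ψ A * wordSum ψ B ≤ wordSum ψ P := by
  have hf : Function.Injective (fun p : A × B => (⟨p.1 ++ p.2, hP _ p.1.2 _ p.2.2⟩ : P)) := by
    rintro ⟨⟨a, ha⟩, ⟨b, hb⟩⟩ ⟨⟨a', ha'⟩, ⟨b', hb'⟩⟩ h
    obtain ⟨rfl, rfl⟩ := List.append_inj (congrArg Subtype.val h) ((hA a ha).trans (hA a' ha').symm)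
    rfl
  calc wordSum ψ A * wordSum ψ B = ∑' p : A × B, wordWeight ψ (p.1 ++ p.2) := by
        rw [ENNReal.tsum_prod (f := fun (a : A) (b : B) => wordWeight ψ (a ++ b))]
        simp only [wordWeight_append, ENNReal.tsum_mul_left, ENNReal.tsum_mul_right, wordSum]
    _ ≤ wordSum ψ P := ENNReal.tsum_comp_le_tsum_of_injective hf fun l : P => wordWeight ψ l

lemma wordSum_le_tsum_fiber {ι : Type*} (P : Set (List Γ)) (κ : List Γ → ι) :
    wordSum ψ P ≤ ∑' i, wordSum ψ {l | l ∈ P ∧ κ l = i} := by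
  have : P ⊆ ⋃ i, {l | l ∈ P ∧ κ l = i} := fun l hl => Set.mem_iUnion.2 ⟨κ l, hl, rfl⟩
  exact (wordSum_mono this).trans (ENNReal.tsum_iUnion_le_tsum (wordWeight ψ) _)

lemma tsum_fiber_le_wordSum {ι : Type*} (P : Set (List Γ)) (κ : List Γ → ι) :
    ∑' i, wordSum ψ {l | l ∈ P ∧ κ l = i} ≤ wordSum ψ P := by
  have hf : Function.Injective
      (fun p : Σ i, {l | l ∈ P ∧ κ l = i} => (⟨p.2, p.2.2.1⟩ : P)) := by
    rintro ⟨i, a, ha, rfl⟩ ⟨j, b, hb, rfl⟩ h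
    obtain rfl : a = b := congrArg Subtype.val h
    rfl
  calc ∑' i, wordSum ψ {l | l ∈ P ∧ κ l = i}
      = ∑' p : Σ i, {l | l ∈ P ∧ κ l = i}, wordWeight ψ p.2 :=
        (ENNReal.tsum_sigma fun i (b : {l | l ∈ P ∧ κ l = i}) => wordWeight ψ b).symm
    _ ≤ wordSum ψ P := ENNReal.tsum_comp_le_tsum_of_injective hf fun l : P => wordWeight ψ l

lemma wordSum_lt_top_of_fiber {ι : Type*} [Finite ι] {P : Set (List Γ)} (κ : List Γ → ι)
    (h : ∀ i, wordSum ψ {l | l ∈ P ∧ κ l = i} < ⊤) : wordSum ψ P < ⊤ := by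
  have := Fintype.ofFinite ι
  refine (wordSum_le_tsum_fiber P κ).trans_lt ?_
  rw [tsum_fintype]
  exact ENNReal.sum_lt_top.2 fun i _ => h i

lemma wordSum_length_le (n : ℕ) :
    wordSum ψ {l | l.length = n} ≤ (∑' γ, ψ γ) ^ n := by
  induction n with
  | zero =>
    rw [pow_zero]
    exact wordSum_nil_le fun l hl => List.length_eq_zero_iff.1 hl
  | succ n ih =>
    have h₁ : wordSum ψ {l : List Γ | l.length = 1} ≤ ∑' γ, ψ γ := by
      have hf : Function.Surjective
          (fun γ : Γ => (⟨[γ], rfl⟩ : {l : List Γ | l.length = 1})) := by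
        rintro ⟨l, hl⟩
        obtain ⟨a, rfl⟩ := List.length_eq_one_iff.1 hl
        exact ⟨a, rfl⟩
      refine (ENNReal.tsum_le_tsum_comp_of_surjective hf fun l => wordWeight ψ l).trans ?_
      simp
    rw [pow_succ']
    refine (wordSum_le_mul (A := {l | l.length = 1}) (fun _ => {l | l.length = n}) ?_
      fun _ _ => ih).trans (by gcongr)
    intro l hl
    cases l with
    | nil => simp at hl
    | cons a l => exact ⟨[a], rfl, l, by simpa using hl, rfl⟩

lemma wordSum_univ_lt_top (h : ∑' γ, ψ γ < 1) : wordSum ψ Set.univ < ⊤ := by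
  refine (wordSum_le_tsum_fiber Set.univ List.length).trans_lt ?_
  calc _ ≤ ∑' n, (∑' γ, ψ γ) ^ n := by
        gcongr with n
        exact (wordSum_mono fun l hl => hl.2).trans (wordSum_length_le n)
    _ < ⊤ := by
        rw [ENNReal.tsum_geometric]
        exact ENNReal.inv_lt_top.2 (tsub_pos_of_lt h)

end Sums

/-! ### Heights along words -/

section Heights

variable {Γ : Type*} [Group Γ]

/-- The height differences of `h` are invariant under left multiplication by `H`. -/
def DiffInvariant (H : Subgroup Γ) (h : Γ → ℤ) : Prop :=
  ∀ α ∈ H, ∀ u v : Γ, h (α * v) - h (α * u) = h v - h u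

lemma DiffInvariant.neg {H : Subgroup Γ} {h : Γ → ℤ} (hh : DiffInvariant H h) :
    DiffInvariant H (-h) := by
  intro α hα u v
  have := hh α hα u v
  simp only [Pi.neg_apply]
  omega

/-- Self-avoiding words which, read from `v`, stay strictly above `v`. -/
def halfSpaceWords (h : Γ → ℤ) (v : Γ) : Set (List Γ) :=
  {l | IsSawWord l ∧ ∀ x ∈ trail v l, h v < h x}

/-- Half-space words climbing at most `n` above the starting point. -/
def boundedHalfSpaceWords (h : Γ → ℤ) (v : Γ) (n : ℕ) : Set (List Γ) :=
  {l | IsSawWord l ∧ ∀ x ∈ trail v l, h v < h x ∧ h x ≤ h v + n}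

/-- Words which are bridges when read from `v`. -/
def bridgeWords (h : Γ → ℤ) (v : Γ) : Set (List Γ) :=
  {l | IsSawWord l ∧ ∀ x ∈ trail v l, h v < h x ∧ h x ≤ h (v * l.prod)}

/-- The height climbed by a word read from `v`. -/
def span (h : Γ → ℤ) (v : Γ) (l : List Γ) : ℤ := h (v * l.prod) - h v

/-- Bridges from the identity that end in the subgroup `H`. -/
def loopBridges (H : Subgroup Γ) (h : Γ → ℤ) : Set (List Γ) :=
  {l | l ∈ bridgeWords h 1 ∧ l.prod ∈ H}

lemma nil_mem_bridgeWords (h : Γ → ℤ) (v : Γ) : [] ∈ bridgeWords h v :=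
  ⟨isSawWord_nil, by simp⟩

lemma nil_mem_loopBridges (H : Subgroup Γ) (h : Γ → ℤ) : ([] : List Γ) ∈ loopBridges H h :=
  ⟨nil_mem_bridgeWords h 1, by simp⟩

lemma height_le_of_mem_bridgeWords {h : Γ → ℤ} {v : Γ} {l : List Γ} (hl : l ∈ bridgeWords h v) :
    h v ≤ h (v * l.prod) := by
  rcases eq_or_ne l [] with rfl | hne
  · simp
  · exact (hl.2 _ (mul_prod_mem_trail v hne)).1.le

/-- The height of the junction separates the two pieces: the first stays at or below it, the second
strictly above it, so they cannot meet. -/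
lemma bridgeWords_append {h : Γ → ℤ} {v : Γ} {l l' : List Γ} (hl : l ∈ bridgeWords h v)
    (hl' : l' ∈ bridgeWords h (v * l.prod)) : l ++ l' ∈ bridgeWords h v := by
  have h₁ := height_le_of_mem_bridgeWords hl
  have h₂ := height_le_of_mem_bridgeWords hl'
  refine ⟨?_, ?_⟩
  · rw [isSawWord_append_iff v]
    refine ⟨(isSawWord_iff v l).1 hl.1, ((isSawWord_iff _ l').1 hl'.1).of_cons, ?_⟩
    rintro a ha b hb rfl
    have hb := (hl'.2 a hb).1
    rcases List.mem_cons.1 ha with rfl | ha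
    · omega
    · exact absurd (hl.2 a ha).2 (not_le.2 hb)
  · intro x hx
    rw [List.prod_append, ← mul_assoc]
    rw [trail_append, List.mem_append] at hx
    rcases hx with hx | hx
    · have := hl.2 x hx
      omega
    · have := hl'.2 x hx
      omega

section Invariance

variable {H : Subgroup Γ} [H.Normal] {h : Γ → ℤ}

/-- The quotient is by left cosets, whereas heights are invariant under left multiplication by `H`;
normality reconciles the two. Hence everything defined by height differences depends only on the
class in the finite quotient. -/
lemma exists_mul_eq_of_mk_eq {u v : Γ} (huv : (u : Γ ⧸ H) = v) : ∃ α ∈ H, α * u = v := by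
  refine ⟨v * u⁻¹, ?_, by simp⟩
  rw [← QuotientGroup.eq_one_iff, QuotientGroup.mk_mul, QuotientGroup.mk_inv, huv, mul_inv_cancel]

lemma bridgeWords_congr (hh : DiffInvariant H h) {u v : Γ} (huv : (u : Γ ⧸ H) = v) :
    bridgeWords h u = bridgeWords h v := by
  obtain ⟨α, hα, rfl⟩ := exists_mul_eq_of_mk_eq huv
  ext l
  simp only [bridgeWords, Set.mem_ofPred_eq, trail_mul, List.forall_mem_map, mul_assoc]
  refine and_congr_right fun _ => forall₂_congr fun x _ => ?_
  have h₁ := hh α hα u x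
  have h₂ := hh α hα x (u * l.prod)
  omega

lemma halfSpaceWords_congr (hh : DiffInvariant H h) {u v : Γ} (huv : (u : Γ ⧸ H) = v) :
    halfSpaceWords h u = halfSpaceWords h v := by
  obtain ⟨α, hα, rfl⟩ := exists_mul_eq_of_mk_eq huv
  ext l
  simp only [halfSpaceWords, Set.mem_ofPred_eq, trail_mul, List.forall_mem_map]
  refine and_congr_right fun _ => forall₂_congr fun x _ => ?_
  have h₁ := hh α hα u x
  omega

lemma span_congr (hh : DiffInvariant H h) {u v : Γ} (huv : (u : Γ ⧸ H) = v) (l : List Γ) :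
    span h u l = span h v l := by
  obtain ⟨α, hα, rfl⟩ := exists_mul_eq_of_mk_eq huv
  simp only [span, mul_assoc]
  exact (hh α hα u (u * l.prod)).symm

lemma bridgeWords_eq_of_mem (hh : DiffInvariant H h) {α : Γ} (hα : α ∈ H) :
    bridgeWords h α = bridgeWords h 1 :=
  bridgeWords_congr hh (by simpa using (QuotientGroup.eq_one_iff (N := H) α).2 hα)

lemma loopBridges_append (hh : DiffInvariant H h) {l l' : List Γ} (hl : l ∈ loopBridges H h)
    (hl' : l' ∈ loopBridges H h) : l ++ l' ∈ loopBridges H h := by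
  refine ⟨bridgeWords_append hl.1 ?_, ?_⟩
  · rw [one_mul, bridgeWords_eq_of_mem hh hl.2]
    exact hl'.1
  · rw [List.prod_append]
    exact H.mul_mem hl.2 hl'.2

end Invariance

/-- Reversing a word that ends at its minimum and prepending a step from a lower vertex. -/
lemma cons_revWord_facts {h : Γ → ℤ} {v γ : Γ} {l : List Γ} (hl : IsSawWord l)
    (hmin : ∀ x ∈ v :: trail v l, h (v * l.prod) ≤ h x)
    (hγ : h (v * l.prod * γ⁻¹) < h (v * l.prod)) :
    γ :: revWord l ∈ halfSpaceWords h (v * l.prod * γ⁻¹) ∧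
      (∀ x, x ∈ trail (v * l.prod * γ⁻¹) (γ :: revWord l) ↔ x ∈ v :: trail v l) ∧
      v * l.prod * γ⁻¹ * (γ :: revWord l).prod = v := by
  have ht : trail (v * l.prod * γ⁻¹) (γ :: revWord l) = (v :: trail v l).reverse := by
    rw [trail_cons, inv_mul_cancel_right, trail_revWord]
  refine ⟨⟨?_, ?_⟩, ?_, ?_⟩
  · rw [isSawWord_iff (v * l.prod * γ⁻¹), ht, List.nodup_cons, List.mem_reverse,
      List.nodup_reverse]
    exact ⟨fun hm => absurd (hmin _ hm) (not_le.2 hγ), (isSawWord_iff v l).1 hl⟩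
  · intro x hx
    rw [ht, List.mem_reverse] at hx
    exact hγ.trans_le (hmin x hx)
  · intro x
    rw [ht, List.mem_reverse]
  · simp [revWord_prod, mul_assoc]

end Heights

/-! ### Decomposition of self-avoiding words into bridges -/

section HammersleyWelsh

variable {Γ : Type*} [Group Γ] {ψ : Γ → ℝ≥0∞} {h : Γ → ℤ}

lemma wordSum_boundedHalfSpaceWords_zero (v : Γ) :
    wordSum ψ (boundedHalfSpaceWords h v 0) ≤ 1 := by
  refine wordSum_nil_le fun l hl => ?_
  by_contra hne
  have := hl.2 _ (mul_prod_mem_trail v hne)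
  simp only [Nat.cast_zero] at this
  omega

/-- Cut at the last visit to the maximal height. If that height is `n + 1` above `v`, the first
piece is a bridge of span `n + 1`; the second stays strictly between the bottom and the top, so it
descends by at most `n` and is a half-space word for `-h`. -/
lemma wordSum_boundedHalfSpaceWords_succ (v : Γ) (n : ℕ) {M : ℝ≥0∞}
    (hM : ∀ u, wordSum ψ (boundedHalfSpaceWords (-h) u n) ≤ M) :
    wordSum ψ (boundedHalfSpaceWords h v (n + 1)) ≤ wordSum ψ (boundedHalfSpaceWords h v n) +
      wordSum ψ {l | l ∈ bridgeWords h v ∧ span h v l = (n + 1 : ℕ)} * M := by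
  let Q : Set (List Γ) := {l | ∃ a ∈ {l | l ∈ bridgeWords h v ∧ span h v l = (n + 1 : ℕ)},
    ∃ b ∈ boundedHalfSpaceWords (-h) (v * a.prod) n, l = a ++ b}
  have hQ : wordSum ψ Q ≤ wordSum ψ {l | l ∈ bridgeWords h v ∧ span h v l = (n + 1 : ℕ)} * M :=
    wordSum_le_mul (fun a => boundedHalfSpaceWords (-h) (v * a.prod) n) (fun l hl => hl)
      fun a _ => hM _
  have hsub : boundedHalfSpaceWords h v (n + 1) ⊆ boundedHalfSpaceWords h v n ∪ Q := by
    intro l hl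
    obtain ⟨l₁, l₂, rfl, h₁, h₂⟩ := exists_split_last_max h v l
    have hmem : ∀ x ∈ trail v (l₁ ++ l₂), h v < h x ∧ h x ≤ h v + (n + 1 : ℕ) := hl.2
    rw [trail_append] at hmem
    have htop : h (v * l₁.prod) ≤ h v + (n + 1 : ℕ) := by
      rcases List.mem_cons.1 (mul_prod_mem v l₁) with he | hm
      · rw [he]; omega
      · exact (hmem _ (List.mem_append_left _ hm)).2
    by_cases hn : h (v * l₁.prod) ≤ h v + n
    · refine Or.inl ⟨hl.1, fun x hx => ⟨(hl.2 x hx).1, ?_⟩⟩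
      rw [trail_append, List.mem_append] at hx
      rcases hx with hx | hx
      · exact (h₁ x (List.mem_cons_of_mem _ hx)).trans hn
      · exact (h₂ x hx).le.trans hn
    · refine Or.inr ⟨l₁, ⟨⟨hl.1.left, fun x hx => ⟨?_, ?_⟩⟩, ?_⟩, l₂, ⟨hl.1.right, ?_⟩, rfl⟩
      · exact (hmem x (List.mem_append_left _ hx)).1
      · exact h₁ x (List.mem_cons_of_mem _ hx)
      · rw [span]; push_cast at htop ⊢; omega
      · intro x hx
        have h₃ := h₂ x hx
        have h₄ := (hmem x (List.mem_append_right _ hx)).1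
        simp only [Pi.neg_apply]
        push_cast at htop
        omega
  exact (wordSum_mono hsub).trans ((wordSum_union_le _ _).trans (by gcongr))

/-- The recursion exchanges `h` and `-h`, so both bounds are carried through one induction. -/
lemma wordSum_boundedHalfSpaceWords_le {E : ℕ → ℝ≥0∞}
    (hE : ∀ v n, wordSum ψ {l | l ∈ bridgeWords h v ∧ span h v l = (n + 1 : ℕ)} ≤ E n)
    (hE' : ∀ v n, wordSum ψ {l | l ∈ bridgeWords (-h) v ∧ span (-h) v l = (n + 1 : ℕ)} ≤ E n)
    (n : ℕ) :
    (∀ v, wordSum ψ (boundedHalfSpaceWords h v n) ≤ ∏ i ∈ Finset.range n, (1 + E i)) ∧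
      ∀ v, wordSum ψ (boundedHalfSpaceWords (-h) v n) ≤ ∏ i ∈ Finset.range n, (1 + E i) := by
  induction n with
  | zero =>
    exact ⟨fun v => by simpa using wordSum_boundedHalfSpaceWords_zero v,
      fun v => by simpa using wordSum_boundedHalfSpaceWords_zero v⟩
  | succ n ih =>
    rw [Finset.prod_range_succ]
    refine ⟨fun v => ?_, fun v => ?_⟩
    · refine (wordSum_boundedHalfSpaceWords_succ v n ih.2).trans ?_
      rw [mul_add, mul_one, mul_comm _ (E n)]
      gcongr
      · exact ih.1 v
      · exact hE v n
    · refine (wordSum_boundedHalfSpaceWords_succ v n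
        (M := ∏ i ∈ Finset.range n, (1 + E i)) ?_).trans ?_
      · rw [neg_neg]; exact ih.1
      rw [mul_add, mul_one, mul_comm _ (E n)]
      gcongr
      · exact ih.2 v
      · exact hE' v n

/-- A sum in `[0, ∞]` is the supremum of its finite partial sums, and finitely many words climb to a
bounded height. -/
lemma wordSum_halfSpaceWords_le {M : ℝ≥0∞} (v : Γ)
    (hM : ∀ n, wordSum ψ (boundedHalfSpaceWords h v n) ≤ M) :
    wordSum ψ (halfSpaceWords h v) ≤ M := by
  rw [wordSum, ENNReal.tsum_eq_iSup_sum]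
  refine iSup_le fun s => ?_
  obtain ⟨n, hn⟩ : ∃ n : ℕ, ∀ l ∈ s, (l : List Γ) ∈ boundedHalfSpaceWords h v n := by
    have key : ∀ l : halfSpaceWords h v, ∃ n : ℕ, ∀ x ∈ trail v (l : List Γ), h x ≤ h v + n := by
      intro l
      obtain ⟨m, hm⟩ := ((trail v (l : List Γ)).finite_toSet.image h).bddAbove
      refine ⟨(m - h v).toNat, fun x hx => ?_⟩
      have := hm (Set.mem_image_of_mem h hx)
      omega
    choose f hf using key
    refine ⟨s.sup f, fun l hl => ⟨l.2.1, fun x hx => ⟨l.2.2 x hx, (hf l x hx).trans ?_⟩⟩⟩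
    have : f l ≤ s.sup f := Finset.le_sup hl
    omega
  refine le_trans ?_ (hM n)
  rw [← Finset.tsum_subtype]
  refine ENNReal.tsum_comp_le_tsum_of_injective
    (f := fun l : s => (⟨l.1, hn l.1 l.2⟩ : boundedHalfSpaceWords h v n)) ?_
    fun l => wordWeight ψ l
  intro a b hab
  exact Subtype.ext (Subtype.ext (Subtype.mk.inj hab))

lemma prod_one_add_le_exp_tsum {E : ℕ → ℝ≥0∞} (hE : ∑' n, E n ≠ ⊤) (n : ℕ) :
    ∏ i ∈ Finset.range n, (1 + E i) ≤ ENNReal.ofReal (Real.exp (∑' n, E n).toReal) := by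
  have htop : ∀ i, E i ≠ ⊤ := ENNReal.ne_top_of_tsum_ne_top hE
  rw [ENNReal.le_ofReal_iff_toReal_le
    (ENNReal.prod_ne_top fun i _ => ENNReal.add_ne_top.2 ⟨ENNReal.one_ne_top, htop i⟩)
    (Real.exp_pos _).le, ENNReal.toReal_prod]
  calc ∏ i ∈ Finset.range n, (1 + E i).toReal = ∏ i ∈ Finset.range n, (1 + (E i).toReal) := by
        refine Finset.prod_congr rfl fun i _ => ?_
        rw [ENNReal.toReal_add ENNReal.one_ne_top (htop i), ENNReal.toReal_one]
    _ ≤ Real.exp (∑ i ∈ Finset.range n, (E i).toReal) :=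
        Real.prod_one_add_le_exp_sum _ fun i => ENNReal.toReal_nonneg
    _ ≤ Real.exp (∑' n, E n).toReal := by
        rw [← ENNReal.toReal_sum fun i _ => htop i]
        gcongr
        exact ENNReal.sum_le_tsum _

variable {H : Subgroup Γ} [H.Normal] [H.FiniteIndex]

/-- If all bridges, upwards and downwards, have finite total weight, then so do the half-space
words, uniformly in the starting point. -/
lemma exists_wordSum_halfSpaceWords_le (hh : DiffInvariant H h)
    (hB : ∀ v, wordSum ψ (bridgeWords h v) < ⊤) (hB' : ∀ v, wordSum ψ (bridgeWords (-h) v) < ⊤) :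
    ∃ M < ⊤, ∀ v, wordSum ψ (halfSpaceWords h v) ≤ M := by
  have := Fintype.ofFinite (Γ ⧸ H)
  -- Summing over the finitely many cosets and both directions gives one sequence that dominates
  -- from every starting point.
  let E : ℕ → ℝ≥0∞ := fun n => ∑ q : Γ ⧸ H,
    (wordSum ψ {l | l ∈ bridgeWords h q.out ∧ span h q.out l = (n + 1 : ℕ)} +
      wordSum ψ {l | l ∈ bridgeWords (-h) q.out ∧ span (-h) q.out l = (n + 1 : ℕ)})
  have hout : ∀ v : Γ, (((v : Γ ⧸ H).out : Γ) : Γ ⧸ H) = v := fun v => QuotientGroup.out_eq' _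
  have h₁ : ∀ v n, wordSum ψ {l | l ∈ bridgeWords h v ∧ span h v l = (n + 1 : ℕ)} ≤ E n := by
    intro v n
    simp only [← bridgeWords_congr hh (hout v), ← span_congr hh (hout v)]
    refine le_trans le_self_add (Finset.single_le_sum
      (f := fun q : Γ ⧸ H =>
        wordSum ψ {l | l ∈ bridgeWords h q.out ∧ span h q.out l = (n + 1 : ℕ)} +
      wordSum ψ {l | l ∈ bridgeWords (-h) q.out ∧ span (-h) q.out l = (n + 1 : ℕ)})
      (fun _ _ => zero_le) (Finset.mem_univ _))
  have h₂ : ∀ v n,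
      wordSum ψ {l | l ∈ bridgeWords (-h) v ∧ span (-h) v l = (n + 1 : ℕ)} ≤ E n := by
    intro v n
    simp only [← bridgeWords_congr hh.neg (hout v), ← span_congr hh.neg (hout v)]
    refine le_trans le_add_self (Finset.single_le_sum
      (f := fun q : Γ ⧸ H =>
        wordSum ψ {l | l ∈ bridgeWords h q.out ∧ span h q.out l = (n + 1 : ℕ)} +
      wordSum ψ {l | l ∈ bridgeWords (-h) q.out ∧ span (-h) q.out l = (n + 1 : ℕ)})
      (fun _ _ => zero_le) (Finset.mem_univ _))
  have hspan : ∀ (g : Γ → ℤ) (v : Γ), ∑' n : ℕ,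
      wordSum ψ {l | l ∈ bridgeWords g v ∧ span g v l = (n + 1 : ℕ)} ≤
        wordSum ψ (bridgeWords g v) := by
    intro g v
    refine le_trans ?_ (tsum_fiber_le_wordSum (bridgeWords g v) (span g v))
    refine ENNReal.tsum_comp_le_tsum_of_injective (f := fun n : ℕ => ((n + 1 : ℕ) : ℤ)) ?_
      fun i => wordSum ψ {l | l ∈ bridgeWords g v ∧ span g v l = i}
    intro a b hab
    simpa using hab
  have hEsum : ∑' n, E n < ⊤ := by
    have : ∑' n, E n = ∑ q : Γ ⧸ H, ∑' n : ℕ,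
      (wordSum ψ {l | l ∈ bridgeWords h q.out ∧ span h q.out l = (n + 1 : ℕ)} +
      wordSum ψ {l | l ∈ bridgeWords (-h) q.out ∧ span (-h) q.out l = (n + 1 : ℕ)}) :=
      Summable.tsum_finsetSum fun _ _ => ENNReal.summable
    rw [this]
    refine ENNReal.sum_lt_top.2 fun q _ => ?_
    rw [ENNReal.tsum_add]
    exact ENNReal.add_lt_top.2 ⟨(hspan h _).trans_lt (hB _), (hspan (-h) _).trans_lt (hB' _)⟩
  refine ⟨ENNReal.ofReal (Real.exp (∑' n, E n).toReal), ENNReal.ofReal_lt_top,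
    fun v => wordSum_halfSpaceWords_le v fun n => ?_⟩
  exact ((wordSum_boundedHalfSpaceWords_le h₁ h₂ n).1 v).trans
    (prod_one_add_le_exp_tsum hEsum.ne n)

/-- A set of words read from `v` has finite total weight if the reversed words, preceded by a step
from a lower vertex, range over sets of finite total weight. -/
lemma wordSum_lt_top_of_revWord (hψ : ∀ γ, ψ γ⁻¹ = ψ γ) (hh : DiffInvariant H h)
    (hlow : ∀ v, ∃ γ, ψ γ ≠ 0 ∧ h (v * γ⁻¹) < h v) (v : Γ) (P : Set (List Γ))
    (Q : Γ → Set (List Γ)) (hQ : ∀ u v : Γ, (u : Γ ⧸ H) = v → Q u = Q v)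
    (hPQ : ∀ l ∈ P, ∀ γ, h (v * l.prod * γ⁻¹) < h (v * l.prod) →
      γ :: revWord l ∈ Q (v * l.prod * γ⁻¹))
    (hfin : ∀ u, wordSum ψ (Q u) < ⊤) : wordSum ψ P < ⊤ := by
  -- Once the coset of the endpoint is fixed, a single downward step `γ` serves all the words, and
  -- its weight is a constant nonzero factor.
  refine wordSum_lt_top_of_fiber (fun l => ((v * l.prod : Γ) : Γ ⧸ H)) fun q => ?_
  obtain ⟨γ, hγ, hγ'⟩ := hlow q.out
  have hmul : ψ γ * wordSum ψ {l | l ∈ P ∧ ((v * l.prod : Γ) : Γ ⧸ H) = q} ≤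
      wordSum ψ (Q (q.out * γ⁻¹)) := by
    refine mul_wordSum_le_of_injOn (fun l => γ :: revWord l) ?_ ?_ ?_
    · intro a _ b _ hab
      exact revWord_injective (List.cons_injective hab)
    · rintro l ⟨hl, rfl⟩
      have hcl : (((v * l.prod : Γ) : Γ ⧸ H).out : Γ ⧸ H) = (v * l.prod : Γ) :=
        QuotientGroup.out_eq' _
      have : Q (((v * l.prod : Γ) : Γ ⧸ H).out * γ⁻¹) = Q (v * l.prod * γ⁻¹) :=
        hQ _ _ (by rw [QuotientGroup.mk_mul, hcl, ← QuotientGroup.mk_mul])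
      rw [this]
      refine hPQ l hl γ ?_
      have := span_congr hh hcl [γ⁻¹]
      simp only [span, List.prod_singleton] at this
      omega
    · intro l _
      rw [wordWeight_cons, wordWeight_revWord hψ]
  by_contra htop
  rw [not_lt_top_iff.1 htop, ENNReal.mul_top hγ] at hmul
  exact (hfin _).ne (top_le_iff.1 hmul)

/-- If the loop bridges have finite total weight, so have all self-avoiding words. -/
theorem wordSum_saw_lt_top (hψ : ∀ γ, ψ γ⁻¹ = ψ γ)
    (hh : DiffInvariant H h) (hlow : ∀ v, ∃ γ, ψ γ ≠ 0 ∧ h (v * γ⁻¹) < h v)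
    (hconn : ∀ u v : Γ, ∃ q ∈ bridgeWords h u, wordWeight ψ q ≠ 0 ∧
      ((u * q.prod : Γ) : Γ ⧸ H) = v)
    (hloop : wordSum ψ (loopBridges H h) < ⊤) : wordSum ψ {l : List Γ | IsSawWord l} < ⊤ := by
  -- With the coset of the endpoint fixed, a bridge from `v` becomes a loop bridge after adding a
  -- fixed bridge before it and another after it.
  have hB : ∀ v, wordSum ψ (bridgeWords h v) < ⊤ := by
    intro v
    refine wordSum_lt_top_of_fiber (fun l => ((v * l.prod : Γ) : Γ ⧸ H)) fun c => ?_
    obtain ⟨q, hq, hq0, hqv⟩ := hconn 1 v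
    obtain ⟨r, hr, hr0, hrv⟩ := hconn c.out 1
    have hmul : wordWeight ψ q * wordWeight ψ r *
        wordSum ψ {l | l ∈ bridgeWords h v ∧ ((v * l.prod : Γ) : Γ ⧸ H) = c} ≤
        wordSum ψ (loopBridges H h) := by
      refine mul_wordSum_le_of_injOn (fun l => q ++ l ++ r) ?_ ?_ ?_
      · intro a _ b _ hab
        exact List.append_cancel_left (List.append_cancel_right hab)
      · rintro l ⟨hl, rfl⟩
        have h₁ : (((1 : Γ) * (q ++ l).prod : Γ) : Γ ⧸ H) = (v * l.prod : Γ) := by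
          rw [List.prod_append, ← mul_assoc, QuotientGroup.mk_mul, hqv, ← QuotientGroup.mk_mul]
        have h₂ : (((1 : Γ) * (q ++ l).prod : Γ) : Γ ⧸ H) =
          ((((v * l.prod : Γ) : Γ ⧸ H).out : Γ) : Γ ⧸ H) := h₁.trans (QuotientGroup.out_eq' _).symm
        refine ⟨bridgeWords_append (bridgeWords_append hq ?_) ?_, ?_⟩
        · rw [bridgeWords_congr hh hqv]; exact hl
        · rw [bridgeWords_congr hh h₂]; exact hr
        · rw [← QuotientGroup.eq_one_iff, List.prod_append, ← one_mul (List.prod (q ++ l)),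
            QuotientGroup.mk_mul, h₂, ← QuotientGroup.mk_mul, hrv, QuotientGroup.mk_one]
      · intro l _
        rw [wordWeight_append, wordWeight_append]
        exact le_of_eq (by ring)
    by_contra htop
    rw [not_lt_top_iff.1 htop, ENNReal.mul_top (mul_ne_zero hq0 hr0)] at hmul
    exact hloop.ne (top_le_iff.1 hmul)
  -- A downward bridge read backwards may revisit its lowest level; a preliminary step from below
  -- makes it a genuine upward bridge.
  have hB' : ∀ v, wordSum ψ (bridgeWords (-h) v) < ⊤ := by
    intro v
    have hmin : ∀ l ∈ bridgeWords (-h) v, ∀ x ∈ v :: trail v l, h (v * l.prod) ≤ h x := by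
      intro l hl x hx
      rcases List.mem_cons.1 hx with rfl | hx
      · have := height_le_of_mem_bridgeWords hl
        simpa using this
      · simpa using (hl.2 x hx).2
    refine wordSum_lt_top_of_revWord hψ hh hlow v _
      (bridgeWords h) (fun _ _ => bridgeWords_congr hh) ?_ hB
    intro l hl γ hγ
    obtain ⟨h₁, h₂, h₃⟩ := cons_revWord_facts hl.1 (hmin l hl) hγ
    refine ⟨h₁.1, fun x hx => ⟨h₁.2 x hx, ?_⟩⟩
    rw [h₃]
    rcases List.mem_cons.1 ((h₂ x).1 hx) with rfl | hx
    · exact le_rfl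
    · have := (hl.2 x hx).1
      simp only [Pi.neg_apply] at this
      omega
  obtain ⟨M, hM, hHS⟩ := exists_wordSum_halfSpaceWords_le hh hB hB'
  -- The part of a walk up to its last minimum of height; what follows is a half-space word.
  let A : Set (List Γ) :=
    {l | IsSawWord l ∧ ∀ x ∈ (1 : Γ) :: trail 1 l, h (1 * l.prod) ≤ h x}
  have hA : wordSum ψ A < ⊤ :=
    wordSum_lt_top_of_revWord hψ hh hlow 1 A
      (halfSpaceWords h) (fun _ _ => halfSpaceWords_congr hh)
      (fun l hl γ hγ => (cons_revWord_facts hl.1 hl.2 hγ).1) fun u => (hHS u).trans_lt hM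
  refine (wordSum_le_mul (A := A) (fun a => halfSpaceWords h (1 * a.prod)) ?_
    fun a _ => hHS _).trans_lt (ENNReal.mul_lt_top hA hM)
  intro l hl
  obtain ⟨l₁, l₂, rfl, h₁, h₂⟩ := exists_split_last_max (-h) 1 l
  refine ⟨l₁, ⟨IsSawWord.left hl, fun x hx => ?_⟩, l₂, ⟨IsSawWord.right hl, fun x hx => ?_⟩, rfl⟩
  · simpa using h₁ x hx
  · simpa using h₂ x hx

end HammersleyWelsh

/-! ### Existence of bridges between prescribed cosets -/

section Connecting

variable {Γ : Type*} [Group Γ] {S : Set Γ} {h : Γ → ℤ}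

lemma exists_ascending_from (hup : ∀ v, ∃ γ ∈ S, h v < h (v * γ)) (k : ℕ) (u : Γ) :
    ∃ l : List Γ, (∀ a ∈ l, a ∈ S) ∧ (∀ x ∈ trail u l, h u < h x ∧ h x ≤ h (u * l.prod)) ∧
      h u + k ≤ h (u * l.prod) := by
  induction k generalizing u with
  | zero => exact ⟨[], by simp⟩
  | succ k ih =>
    obtain ⟨γ, hγ, hlt⟩ := hup u
    obtain ⟨l, hS, ht, hk⟩ := ih (u * γ)
    refine ⟨γ :: l, ?_, ?_, ?_⟩
    · simpa [hγ] using hS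
    · intro x hx
      rw [List.prod_cons, ← mul_assoc]
      rcases List.mem_cons.1 hx with rfl | hx
      · exact ⟨hlt, by omega⟩
      · have := ht x hx
        omega
    · rw [List.prod_cons, ← mul_assoc]
      push_cast
      omega

lemma exists_ascending_to (hlow : ∀ v, ∃ γ ∈ S, h (v * γ⁻¹) < h v) (k : ℕ) (v : Γ) :
    ∃ (u : Γ) (l : List Γ), u * l.prod = v ∧ (∀ a ∈ l, a ∈ S) ∧
      (∀ x ∈ trail u l, h u < h x ∧ h x ≤ h v) ∧ h u + k ≤ h v := by
  induction k with
  | zero => exact ⟨v, [], by simp⟩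
  | succ k ih =>
    obtain ⟨u, l, rfl, hS, ht, hk⟩ := ih
    obtain ⟨γ, hγ, hlt⟩ := hlow u
    refine ⟨u * γ⁻¹, γ :: l, by simp [← mul_assoc], ?_, ?_, ?_⟩
    · simpa [hγ] using hS
    · intro x hx
      rw [trail_cons, inv_mul_cancel_right] at hx
      rcases List.mem_cons.1 hx with rfl | hx
      · exact ⟨hlt, by omega⟩
      · have := ht x hx
        omega
    · push_cast; omega

variable {H : Subgroup Γ} [H.Normal] [H.FiniteIndex]

/-- Any two cosets are joined by words whose height variation is bounded uniformly. -/
lemma exists_bounded_connection (hh : DiffInvariant H h)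
    (hspan : ∀ u v : Γ, ∃ l : List Γ, (∀ a ∈ l, a ∈ S) ∧ u * l.prod = v) :
    ∃ D : ℕ, ∀ u v : Γ, ∃ l : List Γ, (∀ a ∈ l, a ∈ S) ∧ ((u * l.prod : Γ) : Γ ⧸ H) = v ∧
      ∀ x ∈ u :: trail u l, |h x - h u| ≤ D := by
  have := Fintype.ofFinite (Γ ⧸ H)
  choose w hwS hw using fun p : (Γ ⧸ H) × (Γ ⧸ H) => hspan p.1.out p.2.out
  have key : ∀ p : (Γ ⧸ H) × (Γ ⧸ H), ∃ D : ℕ, ∀ x ∈ p.1.out :: trail p.1.out (w p),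
      |h x - h p.1.out| ≤ D := by
    intro p
    obtain ⟨m, hm⟩ := ((p.1.out :: trail p.1.out (w p)).finite_toSet.image
      fun x => |h x - h p.1.out|).bddAbove
    refine ⟨m.toNat, fun x hx => ?_⟩
    have := hm (Set.mem_image_of_mem _ hx)
    omega
  choose D hD using key
  refine ⟨Finset.univ.sup D, fun u v => ?_⟩
  have hp := hw (u, v)
  have hp' := hD (u, v)
  have hS := hwS (u, v)
  generalize w (u, v) = l at hp hp' hS
  refine ⟨l, hS, ?_, ?_⟩
  · have hu : (((u : Γ ⧸ H).out : Γ) : Γ ⧸ H) = u := QuotientGroup.out_eq' _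
    have hv : (((v : Γ ⧸ H).out : Γ) : Γ ⧸ H) = v := QuotientGroup.out_eq' _
    rw [QuotientGroup.mk_mul, ← hu, ← QuotientGroup.mk_mul, hp, hv]
  · intro x hx
    obtain ⟨α, hα, hαu⟩ := exists_mul_eq_of_mk_eq
      (show (((u : Γ ⧸ H).out : Γ) : Γ ⧸ H) = u from QuotientGroup.out_eq' _)
    have ht : u :: trail u l = ((u : Γ ⧸ H).out :: trail (u : Γ ⧸ H).out l).map (α * ·) := by
      rw [List.map_cons, ← trail_mul, hαu]
    rw [ht, List.mem_map] at hx
    obtain ⟨y, hy, rfl⟩ := hx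
    have h₁ := hp' y hy
    have h₂ : D (u, v) ≤ Finset.univ.sup D := Finset.le_sup (Finset.mem_univ _)
    have h₃ := hh α hα (u : Γ ⧸ H).out y
    rw [hαu] at h₃
    rw [h₃]
    exact h₁.trans (by exact_mod_cast h₂)

/-- From any vertex there is a nonempty bridge with letters in `S` to any coset. -/
lemma exists_bridge_to_coset (hh : DiffInvariant H h)
    (hspan : ∀ u v : Γ, ∃ l : List Γ, (∀ a ∈ l, a ∈ S) ∧ u * l.prod = v)
    (hup : ∀ v, ∃ γ ∈ S, h v < h (v * γ)) (hlow : ∀ v, ∃ γ ∈ S, h (v * γ⁻¹) < h v) (u v : Γ) :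
    ∃ q ∈ bridgeWords h u, q ≠ [] ∧ (∀ a ∈ q, a ∈ S) ∧ ((u * q.prod : Γ) : Γ ⧸ H) = v := by
  obtain ⟨D, hD⟩ := exists_bounded_connection hh hspan
  -- The connecting piece deviates by at most `D` from its starting height. An initial climb of `2 *
  -- D + 1` keeps it above `u`, and a final climb of `2 * D + 1` from its endpoint exceeds
  -- everything before it.
  obtain ⟨l₁, hS₁, ht₁, hk₁⟩ := exists_ascending_from hup (2 * D + 1) u
  obtain ⟨v₁, l₃, rfl, hS₃, ht₃, hk₃⟩ := exists_ascending_to hlow (2 * D + 1) v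
  obtain ⟨l₂, hS₂, hc₂, ht₂⟩ := hD (u * l₁.prod) v₁
  obtain ⟨α, hα, hαv⟩ := exists_mul_eq_of_mk_eq hc₂.symm
  have hend := ht₂ _ (mul_prod_mem _ l₂)
  have hk₃' := hh α hα v₁ (v₁ * l₃.prod)
  rw [← mul_assoc, hαv] at hk₃'
  rw [abs_le] at hend
  have hbr : ∀ x ∈ trail u (l₁ ++ l₂ ++ l₃),
      h u < h x ∧ h x ≤ h (u * (l₁ ++ l₂ ++ l₃).prod) := by
    intro x hx
    have hp : u * (l₁ ++ l₂ ++ l₃).prod = u * l₁.prod * l₂.prod * l₃.prod := by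
      simp [List.prod_append, mul_assoc]
    rw [hp]
    rw [trail_append, trail_append, List.mem_append, List.mem_append] at hx
    push_cast at *
    rcases hx with (hx | hx) | hx
    · have := ht₁ x hx
      omega
    · have := ht₂ x (List.mem_cons_of_mem _ hx)
      rw [abs_le] at this
      omega
    · rw [List.prod_append, ← mul_assoc, ← hαv, trail_mul, List.mem_map] at hx
      obtain ⟨y, hy, rfl⟩ := hx
      have h₁ := ht₃ y hy
      have h₂ := hh α hα v₁ y
      rw [hαv] at h₂
      omega
  -- Loop erasure keeps the endpoint and visits no new vertices, so the height bounds survive.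
  obtain ⟨q, hq, hprod, hqS, hqt⟩ := exists_isSawWord_of_word u (l₁ ++ l₂ ++ l₃)
  refine ⟨q, ⟨hq, fun x hx => ?_⟩, ?_, ?_, ?_⟩
  · rw [hprod]
    exact hbr x (hqt x hx)
  · rintro rfl
    have hne : l₁ ++ l₂ ++ l₃ ≠ [] := by
      intro h0
      simp only [List.append_eq_nil_iff] at h0
      rw [h0.1.1] at hk₁
      simp at hk₁
      omega
    have := (hbr _ (mul_prod_mem_trail u hne)).1
    rw [← hprod] at this
    simp at this
  · intro a ha
    have := hqS a ha
    simp only [List.mem_append] at this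
    rcases this with (ha | ha) | ha
    exacts [hS₁ a ha, hS₂ a ha, hS₃ a ha]
  · rw [hprod, List.prod_append, List.prod_append, ← mul_assoc, ← mul_assoc, QuotientGroup.mk_mul,
      hc₂, ← QuotientGroup.mk_mul]

end Connecting

/-! ### Exponentially tilted weights and concatenation of bridges -/

section Tilt

variable {Γ : Type*}

/-- The length of a word: the sum of the lengths of its letters. -/
def wordLength (ℓ : Γ → ℝ) (l : List Γ) : ℝ := (l.map ℓ).sum

/-- The weight function `φ` tilted by `exp (-s ℓ)`. -/
def tilt (φ : Γ → ℝ≥0) (ℓ : Γ → ℝ) (s : ℝ) (γ : Γ) : ℝ≥0∞ :=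
  φ γ * ENNReal.ofReal (Real.exp (-s * ℓ γ))

variable {φ : Γ → ℝ≥0} {ℓ : Γ → ℝ}

@[simp] lemma wordLength_nil : wordLength ℓ [] = 0 := rfl

@[simp] lemma wordLength_cons (a : Γ) (l : List Γ) :
    wordLength ℓ (a :: l) = ℓ a + wordLength ℓ l := by simp [wordLength]

@[simp] lemma wordLength_append (l l' : List Γ) :
    wordLength ℓ (l ++ l') = wordLength ℓ l + wordLength ℓ l' := by simp [wordLength]

lemma length_mul_le_wordLength {δ : ℝ} (hδ : ∀ γ, δ ≤ ℓ γ) (l : List Γ) :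
    l.length * δ ≤ wordLength ℓ l := by
  induction l with
  | nil => simp
  | cons a l ih =>
    have := hδ a
    simp only [List.length_cons, wordLength_cons]
    push_cast
    linarith

lemma ofReal_exp_ne_zero (x : ℝ) : ENNReal.ofReal (Real.exp x) ≠ 0 := by
  simp [Real.exp_pos]

lemma ofReal_exp_add (x y : ℝ) : ENNReal.ofReal (Real.exp (x + y)) =
    ENNReal.ofReal (Real.exp x) * ENNReal.ofReal (Real.exp y) := by
  rw [Real.exp_add, ENNReal.ofReal_mul (Real.exp_pos _).le]

lemma ofReal_exp_nat_mul (n : ℕ) (x : ℝ) : ENNReal.ofReal (Real.exp (n * x)) =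
    ENNReal.ofReal (Real.exp x) ^ n := by
  rw [Real.exp_nat_mul, ENNReal.ofReal_pow (Real.exp_pos _).le]

lemma tilt_ne_zero (s : ℝ) {γ : Γ} (hγ : 0 < φ γ) : tilt φ ℓ s γ ≠ 0 :=
  mul_ne_zero (by simpa using hγ.ne') (ofReal_exp_ne_zero _)

lemma wordWeight_tilt (s : ℝ) (l : List Γ) : wordWeight (tilt φ ℓ s) l =
    wordWeight (fun γ => (φ γ : ℝ≥0∞)) l * ENNReal.ofReal (Real.exp (-s * wordLength ℓ l)) := by
  induction l with
  | nil => simp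
  | cons a l ih =>
    rw [wordWeight_cons, wordWeight_cons, ih, wordLength_cons, mul_add, ofReal_exp_add, tilt]
    ring

lemma wordWeight_tilt_tilt (s s' : ℝ) (l : List Γ) : wordWeight (tilt φ ℓ s') l =
    wordWeight (tilt φ ℓ s) l * ENNReal.ofReal (Real.exp ((s - s') * wordLength ℓ l)) := by
  rw [wordWeight_tilt, wordWeight_tilt, mul_assoc, ← ofReal_exp_add]
  ring_nf

lemma wordSum_le_mul_wordSum {ψ ψ' : Γ → ℝ≥0∞} {P : Set (List Γ)} {c : ℝ≥0∞}
    (hc : ∀ l ∈ P, wordWeight ψ' l ≤ c * wordWeight ψ l) :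
    wordSum ψ' P ≤ c * wordSum ψ P := by
  rw [wordSum, wordSum, ← ENNReal.tsum_mul_left]
  exact ENNReal.tsum_le_tsum fun l => hc l l.2

/-- If the total weight of `P` at the parameter `s'` is infinite, then at any `s < s'` the words of
`P` with a suitable integer part of the length and a suitable number of letters have large total
weight. -/
lemma exists_block {P : Set (List Γ)} {δ : ℝ} (hδ : 0 < δ) (hδℓ : ∀ γ, δ ≤ ℓ γ) {s s' : ℝ}
    (hs : s < s') (htop : wordSum (tilt φ ℓ s') P = ⊤) {K : ℝ≥0∞} (hK : K ≠ ⊤) :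
    ∃ N n : ℕ, K < wordSum (tilt φ ℓ s) {l | l ∈ P ∧ (⌊wordLength ℓ l⌋₊, l.length) = (N, n)} := by
  by_contra! hcon
  -- A length is at least its integer part `N` and at least `n * δ`. Half of the decay `exp (-(s' -
  -- s) ℓ)` is spent on each, so bounded blocks would give a convergent double geometric series.
  set x : ℝ≥0∞ := ENNReal.ofReal (Real.exp (-((s' - s) / 2))) with hx
  set y : ℝ≥0∞ := ENNReal.ofReal (Real.exp (-((s' - s) / 2 * δ))) with hy
  have hlt : ∀ t : ℝ, 0 < t → ENNReal.ofReal (Real.exp (-t)) < 1 := by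
    intro t ht
    rw [ENNReal.ofReal_lt_one, Real.exp_lt_one_iff]
    linarith
  have hx1 : x < 1 := hlt _ (by linarith)
  have hy1 : y < 1 := hlt _ (mul_pos (by linarith) hδ)
  have hfib : ∀ p : ℕ × ℕ,
      wordSum (tilt φ ℓ s') {l | l ∈ P ∧ (⌊wordLength ℓ l⌋₊, l.length) = p} ≤
        x ^ p.1 * y ^ p.2 * K := by
    rintro ⟨N, n⟩
    refine le_trans (wordSum_le_mul_wordSum (ψ := tilt φ ℓ s) (c := x ^ N * y ^ n) ?_)
      (by gcongr; exact hcon N n)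
    rintro l ⟨-, hl⟩
    obtain ⟨hN, hn⟩ := Prod.mk.inj hl
    rw [wordWeight_tilt_tilt s s', mul_comm]
    gcongr
    rw [hx, hy, ← ofReal_exp_nat_mul, ← ofReal_exp_nat_mul, ← ofReal_exp_add]
    gcongr
    have h₁ := length_mul_le_wordLength hδℓ l
    have h₀ : 0 ≤ wordLength ℓ l := le_trans (by positivity) h₁
    have h₂ := Nat.floor_le h₀
    rw [hN] at h₂
    rw [hn] at h₁
    nlinarith
  have : wordSum (tilt φ ℓ s') P < ⊤ := by
    refine (wordSum_le_tsum_fiber P fun l => (⌊wordLength ℓ l⌋₊, l.length)).trans_lt ?_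
    refine (ENNReal.tsum_le_tsum hfib).trans_lt ?_
    rw [ENNReal.tsum_mul_right, ENNReal.tsum_prod (f := fun a b => x ^ a * y ^ b)]
    simp only [ENNReal.tsum_mul_left, ENNReal.tsum_mul_right, ENNReal.tsum_geometric]
    refine ENNReal.mul_lt_top (ENNReal.mul_lt_top ?_ ?_) hK.lt_top
    · exact ENNReal.inv_lt_top.2 (tsub_pos_of_lt hx1)
    · exact ENNReal.inv_lt_top.2 (tsub_pos_of_lt hy1)
  exact this.ne htop

lemma wordWeight_flatten_replicate (ψ : Γ → ℝ≥0∞) (f : List Γ) (j : ℕ) :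
    wordWeight ψ (List.replicate j f).flatten = wordWeight ψ f ^ j := by
  induction j with
  | zero => simp
  | succ j ih => rw [List.replicate_succ, List.flatten_cons, wordWeight_append, ih, pow_succ']

lemma wordLength_flatten_replicate (f : List Γ) (j : ℕ) :
    wordLength ℓ (List.replicate j f).flatten = j * wordLength ℓ f := by
  induction j with
  | zero => simp
  | succ j ih =>
    rw [List.replicate_succ, List.flatten_cons, wordLength_append, ih]
    push_cast
    ring

variable [Group Γ] {H : Subgroup Γ} [H.Normal] {h : Γ → ℤ}

lemma flatten_replicate_mem_loopBridges (hh : DiffInvariant H h) {f : List Γ}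
    (hf : f ∈ loopBridges H h) (j : ℕ) : (List.replicate j f).flatten ∈ loopBridges H h := by
  induction j with
  | zero => exact nil_mem_loopBridges H h
  | succ j ih =>
    rw [List.replicate_succ, List.flatten_cons]
    exact loopBridges_append hh hf ih

/-- A nonempty loop bridge of weight at least one makes the total weight of loop bridges
infinite. -/
lemma wordSum_loopBridges_eq_top (hh : DiffInvariant H h) {ψ : Γ → ℝ≥0∞} {f : List Γ}
    (hf : f ∈ loopBridges H h) (hne : f ≠ []) (h1 : 1 ≤ wordWeight ψ f) :
    wordSum ψ (loopBridges H h) = ⊤ := by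
  have hinj : Function.Injective (fun j : ℕ =>
      (⟨(List.replicate j f).flatten, flatten_replicate_mem_loopBridges hh hf j⟩ :
        loopBridges H h)) := by
    intro i j hij
    have := congrArg List.length (Subtype.mk.inj hij)
    simpa [hne] using this
  refine top_le_iff.1 (le_trans ?_ (ENNReal.tsum_comp_le_tsum_of_injective hinj
    fun l : loopBridges H h => wordWeight ψ l))
  calc (⊤ : ℝ≥0∞) = ∑' _ : ℕ, 1 := (ENNReal.tsum_const_eq_top_of_ne_zero one_ne_zero).symm
    _ ≤ _ := by
      gcongr with j
      rw [wordWeight_flatten_replicate]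
      exact one_le_pow₀ h1

/-- Concatenations of `k` loop bridges with `n` letters and lengths in `[N, N + 1)`. -/
lemma pow_wordSum_block_le (hh : DiffInvariant H h) (ψ : Γ → ℝ≥0∞) (hpos : ∀ γ, 0 < ℓ γ)
    (N n k : ℕ) :
    wordSum ψ {l | l ∈ loopBridges H h ∧ (⌊wordLength ℓ l⌋₊, l.length) = (N, n)} ^ k ≤
      wordSum ψ {l | l ∈ loopBridges H h ∧ l.length = n * k ∧ (k : ℝ) * N ≤ wordLength ℓ l ∧
        wordLength ℓ l ≤ k * (N + 1)} := by
  induction k with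
  | zero =>
    rw [pow_zero]
    have hsub : {([] : List Γ)} ⊆ {l | l ∈ loopBridges H h ∧ l.length = n * 0 ∧
        ((0 : ℕ) : ℝ) * N ≤ wordLength ℓ l ∧ wordLength ℓ l ≤ (0 : ℕ) * (N + 1)} := by
      rintro _ rfl
      exact ⟨nil_mem_loopBridges H h, by simp⟩
    refine le_trans ?_ (wordSum_mono hsub)
    rw [wordSum, tsum_singleton [] (wordWeight ψ), wordWeight_nil]
  | succ k ih =>
    rw [pow_succ']
    refine le_trans (by gcongr) (mul_wordSum_le_of_length (n := n) ?_ ?_)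
    · exact fun a ha => (Prod.mk.inj ha.2).2
    · rintro a ⟨ha, ha'⟩ b ⟨hb, hb₁, hb₂, hb₃⟩
      obtain ⟨hN, hn⟩ := Prod.mk.inj ha'
      have h₀ : 0 ≤ wordLength ℓ a := le_trans (by simp) (length_mul_le_wordLength
        (fun γ => (hpos γ).le) a)
      have h₁ := Nat.floor_le h₀
      have h₂ := Nat.lt_floor_add_one (wordLength ℓ a)
      rw [hN] at h₁ h₂
      refine ⟨loopBridges_append hh ha hb, ?_, ?_, ?_⟩
      · rw [List.length_append, hn, hb₁]; ring
      · rw [wordLength_append]; push_cast; linarith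
      · rw [wordLength_append]; push_cast; linarith

/-- Below the critical parameter, the bridges from `v` with length in a window of fixed width have
total tilted weight bounded below. -/
theorem exists_le_wordSum_bridgeWords (hh : DiffInvariant H h) {δ : ℝ} (hδ : 0 < δ)
    (hδℓ : ∀ γ, δ ≤ ℓ γ) {f : List Γ} (hf : f ∈ loopBridges H h) (hne : f ≠ [])
    (hfφ : ∀ a ∈ f, 0 < φ a) {v : Γ} {q : List Γ} (hq : q ∈ bridgeWords h v)
    (hqφ : ∀ a ∈ q, 0 < φ a) (hqH : ((v * q.prod : Γ) : Γ ⧸ H) = (1 : Γ)) {s s' : ℝ} (hs : s < s')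
    (htop : wordSum (tilt φ ℓ s') (loopBridges H h) = ⊤) :
    ∃ κ : ℝ≥0∞, κ ≠ 0 ∧ ∀ᶠ m : ℕ in atTop, κ ≤ wordSum (tilt φ ℓ s)
      {l | l ∈ bridgeWords h v ∧ (m : ℝ) ≤ wordLength ℓ l ∧
        wordLength ℓ l < m + wordLength ℓ f} := by
  set ψ := tilt φ ℓ s with hψ
  set a := wordLength ℓ f with ha
  have ha0 : 0 < a := by
    refine lt_of_lt_of_le ?_ (length_mul_le_wordLength hδℓ f)
    have : 0 < f.length := List.length_pos_iff.2 hne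
    positivity
  -- The cap at `1` makes powers of `θ` decreasing, so the number of padding copies may be replaced
  -- by an upper bound.
  set θ : ℝ≥0∞ := min 1 (wordWeight ψ f) with hθ
  have hθ0 : θ ≠ 0 := by
    have := wordWeight_ne_zero (ψ := ψ) fun b hb => tilt_ne_zero (ℓ := ℓ) s (hfφ b hb)
    rw [hθ]
    exact (lt_min one_pos (pos_iff_ne_zero.2 this)).ne'
  have hθ1 : θ ≤ 1 := min_le_left _ _
  have hθtop : θ ≠ ⊤ := (hθ1.trans_lt ENNReal.one_lt_top).ne
  obtain ⟨A, hA⟩ := exists_nat_ge (1 / a)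
  -- The length of a block word is uncertain by at most `1`, which about `A` copies of `f` can fill;
  -- the block is chosen to outweigh the cost `θ ^ A`.
  obtain ⟨N, n, hNn⟩ := exists_block (P := loopBridges H h) hδ hδℓ hs htop
    (K := (θ ^ A)⁻¹) (ENNReal.inv_ne_top.2 (pow_ne_zero _ hθ0))
  refine ⟨wordWeight ψ q * θ ^ (A * (N + 1) + 1),
    mul_ne_zero (wordWeight_ne_zero fun b hb => tilt_ne_zero (ℓ := ℓ) s (hqφ b hb))
      (pow_ne_zero _ hθ0), ?_⟩
  obtain ⟨m₀, hm₀⟩ := exists_nat_ge (wordLength ℓ q)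
  filter_upwards [eventually_ge_atTop m₀] with m hm
  have hm' : 0 ≤ (m : ℝ) - wordLength ℓ q := by
    have : (m₀ : ℝ) ≤ m := by exact_mod_cast hm
    linarith
  set t := (m : ℝ) - wordLength ℓ q with ht
  set k := ⌊t / (N + 1)⌋₊ with hk
  have hN1 : (0 : ℝ) < N + 1 := by positivity
  have hk₁ : (k : ℝ) * (N + 1) ≤ t := by
    have := Nat.floor_le (div_nonneg hm' hN1.le)
    rwa [← hk, le_div_iff₀ hN1] at this
  have hk₂ : t < (k + 1) * (N + 1) := by
    have := Nat.lt_floor_add_one (t / (N + 1))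
    rwa [← hk, div_lt_iff₀ hN1] at this
  set X : Set (List Γ) := {l | l ∈ loopBridges H h ∧ l.length = n * k ∧
    (k : ℝ) * N ≤ wordLength ℓ l ∧ wordLength ℓ l ≤ k * (N + 1)} with hX
  -- The least number of copies of `f` that brings the length up to `t`; it overshoots by less than
  -- `a`.
  let j : List Γ → ℕ := fun l => ⌈(t - wordLength ℓ l) / a⌉₊
  have hmain : wordWeight ψ q * θ ^ (A * (k + N + 1) + 1) * wordSum ψ X ≤ wordSum ψ
      {l | l ∈ bridgeWords h v ∧ (m : ℝ) ≤ wordLength ℓ l ∧ wordLength ℓ l < m + a} := by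
    refine mul_wordSum_le_of_injOn (fun l => q ++ (l ++ (List.replicate (j l) f).flatten)) ?_ ?_ ?_
    -- Although the padding depends on the word, the core always has `n * k` letters and is read off
    -- as a prefix.
    · intro x hx y hy hxy
      exact (List.append_inj (List.append_cancel_left hxy) (hx.2.1.trans hy.2.1.symm)).1
    · rintro l ⟨hl, hl₁, hl₂, hl₃⟩
      have hnn : 0 ≤ (t - wordLength ℓ l) / a := div_nonneg (by linarith) ha0.le
      have hj₁ := Nat.le_ceil ((t - wordLength ℓ l) / a)
      have hj₂ := Nat.ceil_lt_add_one hnn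
      rw [div_le_iff₀ ha0] at hj₁
      rw [← sub_lt_iff_lt_add, lt_div_iff₀ ha0] at hj₂
      refine ⟨bridgeWords_append hq ?_, ?_, ?_⟩
      · rw [bridgeWords_congr hh hqH]
        exact (loopBridges_append hh hl (flatten_replicate_mem_loopBridges hh hf _)).1
      · rw [wordLength_append, wordLength_append, wordLength_flatten_replicate]
        linarith
      · rw [wordLength_append, wordLength_append, wordLength_flatten_replicate]
        linarith
    · rintro l ⟨hl, hl₁, hl₂, hl₃⟩
      rw [wordWeight_append, wordWeight_append, wordWeight_flatten_replicate]
      have hnn : 0 ≤ (t - wordLength ℓ l) / a := div_nonneg (by linarith) ha0.le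
      have hj : j l ≤ A * (k + N + 1) + 1 := by
        have hj₂ := Nat.ceil_lt_add_one hnn
        have : (t - wordLength ℓ l) / a ≤ A * (k + N + 1) := by
          calc (t - wordLength ℓ l) / a ≤ (k + N + 1) / a := by
                -- The deficit is at most `(k + 1) * (N + 1) - k * N = k + N + 1`.
                gcongr; nlinarith
            _ = (1 / a) * (k + N + 1) := by ring
            _ ≤ A * (k + N + 1) := by gcongr
        have h₃ : ((j l : ℕ) : ℝ) < ((A * (k + N + 1) + 1 : ℕ) : ℝ) := by
          push_cast
          exact hj₂.trans_le (by linarith)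
        exact (Nat.cast_lt.1 h₃).le
      have hpow : θ ^ (A * (k + N + 1) + 1) ≤ wordWeight ψ f ^ j l :=
        (pow_le_pow_of_le_one zero_le hθ1 hj).trans
          (pow_le_pow_left₀ zero_le (min_le_right _ _) _)
      calc wordWeight ψ q * θ ^ (A * (k + N + 1) + 1) * wordWeight ψ l
          ≤ wordWeight ψ q * wordWeight ψ f ^ j l * wordWeight ψ l :=
            mul_le_mul' (mul_le_mul' le_rfl hpow) le_rfl
        _ = _ := by ring
  refine le_trans ?_ hmain
  have hone : 1 ≤ θ ^ (A * k) * wordSum ψ X := by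
    have hc : 1 ≤ θ ^ A *
        wordSum ψ {l | l ∈ loopBridges H h ∧ (⌊wordLength ℓ l⌋₊, l.length) = (N, n)} := by
      rw [← ENNReal.mul_inv_cancel (pow_ne_zero A hθ0) (ENNReal.pow_ne_top hθtop)]
      gcongr
    calc (1 : ℝ≥0∞) ≤ (θ ^ A * wordSum ψ
          {l | l ∈ loopBridges H h ∧ (⌊wordLength ℓ l⌋₊, l.length) = (N, n)}) ^ k :=
          one_le_pow₀ hc
      _ ≤ θ ^ (A * k) * wordSum ψ X := by
          rw [mul_pow, ← pow_mul]
          gcongr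
          exact pow_wordSum_block_le hh ψ (fun γ => hδ.trans_le (hδℓ γ)) N n k
  calc wordWeight ψ q * θ ^ (A * (N + 1) + 1)
      ≤ wordWeight ψ q * θ ^ (A * (N + 1) + 1) * (θ ^ (A * k) * wordSum ψ X) :=
        le_mul_of_one_le_right' hone
    _ = wordWeight ψ q * θ ^ (A * (k + N + 1) + 1) * wordSum ψ X := by
        rw [show A * (k + N + 1) + 1 = A * (N + 1) + 1 + A * k by ring, pow_add]
        ring

end Tilt

/-! ### Self-avoiding walks and words -/

section Walks

variable {Γ : Type*} [Group Γ]

/-- The word of increments of a walk. -/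
def toWord {v u : Γ} (p : (⊤ : SimpleGraph Γ).Walk v u) : List Γ :=
  p.darts.map fun d => d.fst⁻¹ * d.snd

lemma walkWeight_eq (φ : Γ → ℝ≥0) {v u : Γ} (p : (⊤ : SimpleGraph Γ).Walk v u) :
    (walkWeight φ p : ℝ≥0∞) = wordWeight (fun γ => (φ γ : ℝ≥0∞)) (toWord p) := by
  refine (map_list_prod ENNReal.ofNNRealHom _).trans ?_
  rw [wordWeight, toWord, List.map_map, List.map_map]
  rfl

lemma walkLength_eq (ℓ : Γ → ℝ) {v u : Γ} (p : (⊤ : SimpleGraph Γ).Walk v u) :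
    walkLength ℓ p = wordLength ℓ (toWord p) := by
  rw [walkLength, wordLength, toWord, List.map_map]
  rfl

lemma support_eq_trail {v u : Γ} (p : (⊤ : SimpleGraph Γ).Walk v u) :
    p.support = v :: trail v (toWord p) := by
  induction p with
  | nil => rfl
  | @cons a b c hab p ih =>
    rw [SimpleGraph.Walk.support_cons, ih]
    simp [toWord]

lemma mul_toWord_prod {v u : Γ} (p : (⊤ : SimpleGraph Γ).Walk v u) : v * (toWord p).prod = u := by
  induction p with
  | nil => simp [toWord]
  | @cons a b c hab p ih =>
    refine Eq.trans ?_ ih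
    simp [toWord, ← mul_assoc]

lemma toWord_injective (v : Γ) : Function.Injective fun π : SAW v => toWord π.2.1 := by
  rintro ⟨u, p, hp⟩ ⟨u', p', hp'⟩ hpp
  dsimp only at hpp
  obtain rfl : u = u' := by rw [← mul_toWord_prod p, ← mul_toWord_prod p', hpp]
  obtain rfl : p = p' := by
    apply SimpleGraph.Walk.ext_support
    rw [support_eq_trail, support_eq_trail, hpp]
  rfl

lemma isSawWord_toWord {v : Γ} (π : SAW v) : IsSawWord (toWord π.2.1) := by
  rw [isSawWord_iff v, ← support_eq_trail]
  exact π.2.2.support_nodup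

lemma exists_toWord_eq {v : Γ} {l : List Γ} (hl : IsSawWord l) :
    ∃ π : SAW v, toWord π.2.1 = l := by
  have key : ∀ (l : List Γ) (v : Γ), (v :: trail v l).Nodup →
      ∃ (u : Γ) (p : (⊤ : SimpleGraph Γ).Walk v u), toWord p = l := by
    intro l
    induction l with
    | nil => exact fun v _ => ⟨v, SimpleGraph.Walk.nil, rfl⟩
    | cons a l ih =>
      intro v hv
      rw [trail_cons] at hv
      obtain ⟨u, p, hp⟩ := ih (v * a) hv.of_cons
      have hne : (⊤ : SimpleGraph Γ).Adj v (v * a) := by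
        rw [SimpleGraph.top_adj]
        intro he
        exact (List.nodup_cons.1 hv).1 (he ▸ List.mem_cons_self)
      refine ⟨u, SimpleGraph.Walk.cons hne p, ?_⟩
      rw [← hp]
      simp [toWord]
  obtain ⟨u, p, rfl⟩ := key l v ((isSawWord_iff v l).1 hl)
  refine ⟨⟨u, p, ?_⟩, rfl⟩
  rw [SimpleGraph.Walk.isPath_def, support_eq_trail]
  exact (isSawWord_iff v _).1 hl

/-- The total weight of a set of self-avoiding walks is that of the corresponding words. -/
lemma totalWeight_eq_wordSum (φ : Γ → ℝ≥0) {v : Γ} (P : Set (SAW v)) (Q : Set (List Γ))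
    (hPQ : ∀ π : SAW v, π ∈ P ↔ toWord π.2.1 ∈ Q) (hQ : ∀ l ∈ Q, IsSawWord l) :
    totalWeight φ P = wordSum (fun γ => (φ γ : ℝ≥0∞)) Q := by
  let e : P ≃ Q := Equiv.ofBijective (fun π => ⟨toWord π.1.2.1, (hPQ _).1 π.2⟩) (by
    constructor
    · intro a b hab
      exact Subtype.ext (toWord_injective v (Subtype.mk.inj hab))
    · rintro ⟨l, hl⟩
      obtain ⟨π, rfl⟩ := exists_toWord_eq (v := v) (hQ l hl)
      exact ⟨⟨π, (hPQ π).2 hl⟩, rfl⟩)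
  rw [totalWeight, wordSum, ← e.tsum_eq]
  exact tsum_congr fun π => walkWeight_eq φ _

lemma totalWeight_sawSet (φ : Γ → ℝ≥0) (ℓ : Γ → ℝ) (m c : ℝ) (v : Γ) :
    totalWeight φ (sawSet ℓ m c v) = wordSum (fun γ => (φ γ : ℝ≥0∞))
      {l | IsSawWord l ∧ m ≤ wordLength ℓ l ∧ wordLength ℓ l < m + c} := by
  refine totalWeight_eq_wordSum φ _ _ (fun π => ?_) fun l hl => hl.1
  simp only [sawSet, Set.mem_ofPred_eq, walkLength_eq, isSawWord_toWord, true_and]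

lemma totalWeight_bridgeSet (h : Γ → ℤ) (φ : Γ → ℝ≥0) (ℓ : Γ → ℝ) (m c : ℝ) (v : Γ) :
    totalWeight φ (bridgeSet h ℓ m c v) = wordSum (fun γ => (φ γ : ℝ≥0∞))
      {l | l ∈ bridgeWords h v ∧ m ≤ wordLength ℓ l ∧ wordLength ℓ l < m + c} := by
  refine totalWeight_eq_wordSum φ _ _ (fun π => ?_) fun l hl => hl.1.1
  simp only [bridgeSet, bridgeWords, IsBridge, Set.mem_ofPred_eq, walkLength_eq,
    isSawWord_toWord, true_and, support_eq_trail, List.tail_cons, mul_toWord_prod]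

end Walks

/-! ### Roots of exponentially bounded sequences -/

section Roots

lemma tendsto_const_rpow_one_div {K : ℝ≥0∞} (h0 : K ≠ 0) (htop : K ≠ ⊤) :
    Tendsto (fun m : ℕ => K ^ (1 / (m : ℝ))) atTop (𝓝 1) := by
  have h1 : Tendsto (fun m : ℕ => 1 / (m : ℝ)) atTop (𝓝 0) := tendsto_one_div_atTop_nhds_zero_nat
  lift K to ℝ≥0 using htop
  have hK : K ≠ 0 := by simpa using h0
  have h2 : Tendsto (fun m : ℕ => K ^ (1 / (m : ℝ))) atTop (𝓝 (K ^ (0 : ℝ))) :=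
    tendsto_const_nhds.nnrpow h1 (Or.inl hK)
  rw [NNReal.rpow_zero] at h2
  refine (ENNReal.tendsto_coe.2 h2).congr fun m => ?_
  exact ENNReal.coe_rpow_of_ne_zero hK _

lemma mul_pow_rpow_one_div (K x : ℝ≥0∞) {m : ℕ} (hm : m ≠ 0) :
    (K * x ^ m) ^ (1 / (m : ℝ)) = K ^ (1 / (m : ℝ)) * x := by
  rw [ENNReal.mul_rpow_of_nonneg _ _ (by positivity), ← ENNReal.rpow_natCast, ← ENNReal.rpow_mul,
    mul_one_div_cancel (by exact_mod_cast hm), ENNReal.rpow_one]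

lemma tendsto_mul_pow_rpow {K x : ℝ≥0∞} (h0 : K ≠ 0) (htop : K ≠ ⊤) :
    Tendsto (fun m : ℕ => (K * x ^ m) ^ (1 / (m : ℝ))) atTop (𝓝 x) := by
  have h := ENNReal.Tendsto.mul_const (b := x) (tendsto_const_rpow_one_div h0 htop)
    (Or.inl one_ne_zero)
  rw [one_mul] at h
  refine h.congr' ?_
  filter_upwards [eventually_ne_atTop 0] with m hm
  rw [mul_pow_rpow_one_div K x hm]

lemma limsup_rpow_le {a : ℕ → ℝ≥0∞} {K x : ℝ≥0∞} (hK : K ≠ ⊤)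
    (ha : ∀ᶠ m in atTop, a m ≤ K * x ^ m) :
    limsup (fun m : ℕ => a m ^ (1 / (m : ℝ))) atTop ≤ x := by
  -- The constant may be `0`, whose roots do not tend to `1`.
  have hlim := tendsto_mul_pow_rpow (K := max K 1) (x := x)
    (lt_of_lt_of_le one_pos (le_max_right _ _)).ne' (max_lt hK.lt_top ENNReal.one_lt_top).ne
  rw [← hlim.limsup_eq]
  refine limsup_le_limsup ?_
  filter_upwards [ha] with m hm
  exact ENNReal.rpow_le_rpow (hm.trans (by gcongr; exact le_max_left _ _)) (by positivity)

lemma le_liminf_rpow {a : ℕ → ℝ≥0∞} {K x : ℝ≥0∞} (hK : K ≠ 0)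
    (ha : ∀ᶠ m in atTop, K * x ^ m ≤ a m) :
    x ≤ liminf (fun m : ℕ => a m ^ (1 / (m : ℝ))) atTop := by
  have hlim := tendsto_mul_pow_rpow (K := min K 1) (x := x)
    (lt_min (pos_iff_ne_zero.2 hK) one_pos).ne' ((min_le_right _ _).trans_lt ENNReal.one_lt_top).ne
  rw [← hlim.liminf_eq]
  refine liminf_le_liminf ?_
  filter_upwards [ha] with m hm
  exact ENNReal.rpow_le_rpow (le_trans (by gcongr; exact min_le_left _ _) hm) (by positivity)

/-- The limit superior of roots of the weights of windows does not depend on the width of the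
windows, provided it is at least one. -/
lemma limsup_window_eq {Γ : Type*} [Group Γ] (φ : Γ → ℝ≥0) (ℓ : Γ → ℝ) {c : ℝ} (hc : 1 ≤ c) :
    limsup (fun m : ℕ => totalWeight φ (sawSet ℓ m c (1 : Γ)) ^ (1 / (m : ℝ))) atTop =
      limsup (fun m : ℕ => totalWeight φ (sawSet ℓ m 1 (1 : Γ)) ^ (1 / (m : ℝ))) atTop := by
  apply le_antisymm
  · refine le_of_forall_gt_imp_ge_of_dense fun x hx => ?_
    rcases eq_or_ne x ⊤ with rfl | hxtop
    · exact le_top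
    obtain ⟨J, hJ⟩ := exists_nat_ge c
    have hev : ∀ᶠ m : ℕ in atTop, totalWeight φ (sawSet ℓ m 1 (1 : Γ)) ≤ x ^ m := by
      filter_upwards [eventually_lt_of_limsup_lt hx, eventually_ne_atTop 0] with m hm hm0
      rw [← ENNReal.rpow_natCast]
      rw [one_div] at hm
      exact (ENNReal.rpow_inv_le_iff (by positivity)).1 hm.le
    obtain ⟨m₀, hm₀⟩ := eventually_atTop.1 hev
    refine limsup_rpow_le (K := ∑ i ∈ Finset.range J, x ^ i)
      (ENNReal.sum_ne_top.2 fun i _ => ENNReal.pow_ne_top hxtop) ?_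
    filter_upwards [eventually_ge_atTop m₀] with m hm
    -- The window is covered by `J` unit windows; their offsets contribute only the finite constant
    -- `∑ x ^ i`.
    have hsub : sawSet ℓ m c (1 : Γ) ⊆
        ⋃ i ∈ Finset.range J, sawSet ℓ ((m + i : ℕ) : ℝ) 1 (1 : Γ) := by
      rintro π ⟨h₁, h₂⟩
      have hnn : 0 ≤ walkLength ℓ π.2.1 - m := by linarith
      refine Set.mem_biUnion (x := ⌊walkLength ℓ π.2.1 - m⌋₊) ?_ ⟨?_, ?_⟩
      · rw [Finset.mem_coe, Finset.mem_range, Nat.floor_lt hnn]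
        linarith
      · have := Nat.floor_le hnn
        push_cast
        linarith
      · have := Nat.lt_floor_add_one (walkLength ℓ π.2.1 - m)
        push_cast
        linarith
    calc totalWeight φ (sawSet ℓ m c (1 : Γ))
        ≤ ∑ i ∈ Finset.range J, totalWeight φ (sawSet ℓ ((m + i : ℕ) : ℝ) 1 (1 : Γ)) :=
          (ENNReal.tsum_mono_subtype (fun π : SAW (1 : Γ) => (walkWeight φ π.2.1 : ℝ≥0∞))
            hsub).trans (ENNReal.tsum_biUnion_le
              (fun π : SAW (1 : Γ) => (walkWeight φ π.2.1 : ℝ≥0∞)) _ _)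
      _ ≤ ∑ i ∈ Finset.range J, x ^ (m + i) := by
          gcongr with i
          exact hm₀ _ (by omega)
      _ = (∑ i ∈ Finset.range J, x ^ i) * x ^ m := by
          rw [Finset.sum_mul]
          exact Finset.sum_congr rfl fun i _ => by rw [pow_add, mul_comm]
  · refine limsup_le_limsup (Eventually.of_forall fun m => ?_)
    refine ENNReal.rpow_le_rpow (ENNReal.tsum_mono_subtype
      (fun π : SAW (1 : Γ) => (walkWeight φ π.2.1 : ℝ≥0∞)) ?_) (by positivity)
    rintro π ⟨h₁, h₂⟩
    exact ⟨h₁, by linarith⟩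

end Roots

/-! ### The critical parameter -/

section Critical

variable {Γ : Type*} [Group Γ] {φ : Γ → ℝ≥0} {h : Γ → ℤ} {H : Subgroup Γ} {ℓ : Γ → ℝ}

lemma IsLengthFunction.iInf_le (hℓ : IsLengthFunction ℓ) (γ : Γ) : ⨅ γ, ℓ γ ≤ ℓ γ :=
  ciInf_le ⟨0, by rintro _ ⟨γ, rfl⟩; exact (hℓ.pos γ).le⟩ γ

lemma IsWeightFunction.exists_word (hφ : IsWeightFunction φ) (u v : Γ) :
    ∃ l : List Γ, (∀ a ∈ l, a ∈ {γ | 0 < φ γ}) ∧ u * l.prod = v := by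
  obtain ⟨π, hπ⟩ := hφ.spans u v
  refine ⟨toWord π.1, fun a ha => ?_, mul_toWord_prod π.1⟩
  obtain ⟨d, hd, rfl⟩ := List.mem_map.1 ha
  refine pos_iff_ne_zero.2 fun h0 : φ (d.fst⁻¹ * d.snd) = 0 => hπ.ne' ?_
  exact List.prod_eq_zero_iff.2 (List.mem_map.2 ⟨d, hd, h0⟩)

lemma supportGraph_adj_pos (hφ : IsWeightFunction φ) {u v : Γ} (huv : (supportGraph φ).Adj u v) :
    0 < φ (u⁻¹ * v) := by
  rw [supportGraph, SimpleGraph.mulCayley_adj] at huv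
  rcases huv.2 with h | h
  · exact h
  · rw [← hφ.symm]
    simpa using h

lemma exists_step_up (hφ : IsWeightFunction φ)
    (hh : IsStrongHeightFunction (supportGraph φ) h H) (v : Γ) :
    ∃ γ ∈ {γ | 0 < φ γ}, h v < h (v * γ) := by
  obtain ⟨-, w, -, hw, -, hlt⟩ := hh.exists_lower_upper v
  exact ⟨v⁻¹ * w, supportGraph_adj_pos hφ hw, by simpa using hlt⟩

lemma exists_step_down (hφ : IsWeightFunction φ)
    (hh : IsStrongHeightFunction (supportGraph φ) h H) (v : Γ) :
    ∃ γ ∈ {γ | 0 < φ γ}, h (v * γ⁻¹) < h v := by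
  obtain ⟨u, -, hu, -, hlt, -⟩ := hh.exists_lower_upper v
  exact ⟨u⁻¹ * v, supportGraph_adj_pos hφ hu.symm, by simpa using hlt⟩

/-- The parameters at which the loop bridges have finite total tilted weight. -/
def finiteParams (H : Subgroup Γ) (h : Γ → ℤ) (φ : Γ → ℝ≥0) (ℓ : Γ → ℝ) : Set ℝ :=
  {s | wordSum (tilt φ ℓ s) (loopBridges H h) < ⊤}

/-- As `ℓ` is bounded below by `δ > 0`, the tilted weights of single letters sum to at most `exp (-s
δ) ∑ φ`. For large `s` this is below `1`, and the sum over all words, self-avoiding or not, is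
dominated by a geometric series. -/
lemma finiteParams_nonempty (hφ : IsWeightFunction φ) (hℓ : IsLengthFunction ℓ) :
    (finiteParams H h φ ℓ).Nonempty := by
  have hδ := hℓ.lenMin_pos
  set δ := ⨅ γ, ℓ γ
  have hδℓ : ∀ γ, δ ≤ ℓ γ := hℓ.iInf_le
  have htop : ∑' γ, (φ γ : ℝ≥0∞) ≠ ⊤ := ENNReal.tsum_coe_ne_top_iff_summable.2 hφ.summable
  have hlim : Tendsto (fun s : ℝ => ENNReal.ofReal (Real.exp (-(s * δ))) * ∑' γ, (φ γ : ℝ≥0∞))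
      atTop (𝓝 0) := by
    have h₁ : Tendsto (fun s : ℝ => ENNReal.ofReal (Real.exp (-(s * δ)))) atTop (𝓝 0) := by
      rw [← ENNReal.ofReal_zero]
      exact ENNReal.tendsto_ofReal
        (Real.tendsto_exp_neg_atTop_nhds_zero.comp (tendsto_id.atTop_mul_const hδ))
    simpa using ENNReal.Tendsto.mul_const h₁ (Or.inr htop)
  obtain ⟨s, hs1, hs0⟩ := ((hlim.eventually (gt_mem_nhds one_pos)).and
    (eventually_ge_atTop 0)).exists
  refine ⟨s, (wordSum_mono (Set.subset_univ _)).trans_lt (wordSum_univ_lt_top ?_)⟩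
  refine lt_of_le_of_lt ?_ hs1
  rw [← ENNReal.tsum_mul_left]
  refine ENNReal.tsum_le_tsum fun γ => ?_
  rw [tilt, mul_comm]
  gcongr
  have := mul_le_mul_of_nonneg_left (hδℓ γ) hs0
  linarith

variable [H.Normal]

/-- For `s` small enough the loop bridge `f` has tilted weight at least `1`, and its powers alone
make the sum diverge. -/
lemma finiteParams_bddBelow (hh : DiffInvariant H h) (hpos : ∀ γ, 0 < ℓ γ) {f : List Γ}
    (hf : f ∈ loopBridges H h) (hne : f ≠ []) (hfφ : ∀ a ∈ f, 0 < φ a) :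
    BddBelow (finiteParams H h φ ℓ) := by
  set w := wordWeight (fun γ => (φ γ : ℝ≥0∞)) f with hw
  have hw0 : w ≠ 0 := wordWeight_ne_zero fun a ha => by simpa using (hfφ a ha).ne'
  have hwtop : w ≠ ⊤ := wordWeight_ne_top (fun γ => ENNReal.coe_ne_top) f
  have hlen : 0 < wordLength ℓ f := by
    cases f with
    | nil => exact absurd rfl hne
    | cons a l =>
      rw [wordLength_cons]
      have := length_mul_le_wordLength (fun γ => (hpos γ).le) l
      have := hpos a
      linarith
  refine ⟨Real.log w.toReal / wordLength ℓ f, fun s hs => ?_⟩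
  by_contra! hlt
  refine hs.ne (wordSum_loopBridges_eq_top hh hf hne ?_)
  have hwr : 0 < w.toReal := ENNReal.toReal_pos hw0 hwtop
  rw [wordWeight_tilt, ← hw, ← ENNReal.ofReal_toReal hwtop, ← ENNReal.ofReal_mul hwr.le,
    ENNReal.one_le_ofReal]
  rw [lt_div_iff₀ hlen] at hlt
  calc (1 : ℝ) = Real.exp (s * wordLength ℓ f) * Real.exp (-s * wordLength ℓ f) := by
        rw [← Real.exp_add]; simp
    _ ≤ w.toReal * Real.exp (-s * wordLength ℓ f) := by
        gcongr
        rw [← Real.le_log_iff_exp_le hwr]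
        exact hlt.le

/-- The exponential of the critical parameter. -/
def criticalValue (H : Subgroup Γ) (h : Γ → ℤ) (φ : Γ → ℝ≥0) (ℓ : Γ → ℝ) : ℝ≥0∞ :=
  ENNReal.ofReal (Real.exp (sInf (finiteParams H h φ ℓ)))

lemma tendsto_ofReal_exp (s : ℝ) (t : Set ℝ) :
    Tendsto (fun s => ENNReal.ofReal (Real.exp s)) (𝓝[t] s) (𝓝 (ENNReal.ofReal (Real.exp s))) :=
  (ENNReal.tendsto_ofReal (Real.continuous_exp.tendsto s)).mono_left nhdsWithin_le_nhds

/-- Within a window, tilting amounts to the factor `exp (-m s)` up to `exp (|s| c)`, whatever the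
sign of `s`. -/
lemma mul_window_le {s c m t : ℝ} (h₁ : m ≤ t) (h₂ : t < m + c) :
    |s * t - m * s| ≤ |s| * c := by
  rw [show s * t - m * s = s * (t - m) by ring, abs_mul, abs_of_nonneg (sub_nonneg.2 h₁)]
  gcongr
  linarith

lemma limsup_sawSet_le [H.FiniteIndex] (hφ : IsWeightFunction φ)
    (hh : IsStrongHeightFunction (supportGraph φ) h H) (hℓ : IsLengthFunction ℓ)
    (c : ℝ) :
    limsup (fun m : ℕ => totalWeight φ (sawSet ℓ m c (1 : Γ)) ^ (1 / (m : ℝ))) atTop ≤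
      criticalValue H h φ ℓ := by
  have hT : ∀ s ∈ finiteParams H h φ ℓ,
      limsup (fun m : ℕ => totalWeight φ (sawSet ℓ m c (1 : Γ)) ^ (1 / (m : ℝ))) atTop ≤
        ENNReal.ofReal (Real.exp s) := by
    intro s hs
    have hZ : wordSum (tilt φ ℓ s) {l : List Γ | IsSawWord l} < ⊤ := by
      refine wordSum_saw_lt_top (h := h) (H := H) (fun γ => ?_) hh.diff_invariant (fun v => ?_)
        (fun u v => ?_) hs
      · rw [tilt, tilt, hφ.symm, hℓ.symm]
      · obtain ⟨γ, hγ, hlt⟩ := exists_step_down hφ hh v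
        exact ⟨γ, tilt_ne_zero s hγ, hlt⟩
      · obtain ⟨q, hq, -, hqφ, hqv⟩ := exists_bridge_to_coset hh.diff_invariant
          (fun u v => hφ.exists_word u v) (exists_step_up hφ hh) (exists_step_down hφ hh) u v
        exact ⟨q, hq, wordWeight_ne_zero fun a ha => tilt_ne_zero s (hqφ a ha), hqv⟩
    refine limsup_rpow_le (K := ENNReal.ofReal (Real.exp (|s| * c)) *
      wordSum (tilt φ ℓ s) {l : List Γ | IsSawWord l})
      (ENNReal.mul_ne_top ENNReal.ofReal_ne_top hZ.ne) (Eventually.of_forall fun m => ?_)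
    rw [totalWeight_sawSet, ← ofReal_exp_nat_mul, mul_right_comm, ← ofReal_exp_add]
    refine (wordSum_le_mul_wordSum (ψ := tilt φ ℓ s)
      (c := ENNReal.ofReal (Real.exp (|s| * c + m * s))) ?_).trans ?_
    · rintro l ⟨-, h₁, h₂⟩
      rw [wordWeight_tilt, mul_left_comm, ← ofReal_exp_add]
      refine le_mul_of_one_le_right' ?_
      rw [ENNReal.one_le_ofReal, Real.one_le_exp_iff]
      have := (abs_le.1 (mul_window_le (s := s) h₁ h₂)).2
      linarith
    · gcongr
      exact wordSum_mono fun l hl => hl.1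
  -- The infimum need not be attained, so the bound is obtained for `s` above it and passed to the
  -- limit.
  refine ge_of_tendsto
    (tendsto_ofReal_exp _ (Set.Ioi (sInf (finiteParams H h φ ℓ)))) ?_
  filter_upwards [self_mem_nhdsWithin] with s hs
  obtain ⟨s₀, hs₀, hlt⟩ := exists_lt_of_csInf_lt (finiteParams_nonempty hφ hℓ) hs
  refine (hT s₀ hs₀).trans ?_
  gcongr

lemma exists_le_liminf_bridgeSet [H.FiniteIndex] (hφ : IsWeightFunction φ)
    (hh : IsStrongHeightFunction (supportGraph φ) h H) (hℓ : IsLengthFunction ℓ) :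
    ∃ c₀ : ℝ, ∀ c ≥ c₀, ∀ v : Γ, criticalValue H h φ ℓ ≤
      liminf (fun m : ℕ => totalWeight φ (bridgeSet h ℓ m c v) ^ (1 / (m : ℝ))) atTop := by
  have hbr := exists_bridge_to_coset (H := H) hh.diff_invariant
    (fun u v => hφ.exists_word u v) (exists_step_up hφ hh) (exists_step_down hφ hh)
  obtain ⟨f, hf, hne, hfφ, hfH⟩ := hbr 1 1
  have hfl : f ∈ loopBridges H h := by
    refine ⟨hf, (QuotientGroup.eq_one_iff _).1 ?_⟩
    simpa using hfH
  -- The same padding loop `f` serves every starting point, so the threshold does not depend on `v`.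
  refine ⟨wordLength ℓ f, fun c hc v => ?_⟩
  obtain ⟨q, hq, -, hqφ, hqv⟩ := hbr v 1
  have hbdd := finiteParams_bddBelow (φ := φ) hh.diff_invariant hℓ.pos hfl hne hfφ
  refine le_of_tendsto
    (tendsto_ofReal_exp _ (Set.Iio (sInf (finiteParams H h φ ℓ)))) ?_
  filter_upwards [self_mem_nhdsWithin] with s hs
  -- Divergence is used at `s'`, strictly above `s`; the gap supplies the decay in `exists_block`.
  obtain ⟨s', hs', hlt⟩ := exists_between (Set.mem_Iio.1 hs)
  have htop : wordSum (tilt φ ℓ s') (loopBridges H h) = ⊤ :=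
    not_lt_top_iff.1 fun hfin => (csInf_le hbdd hfin).not_gt hlt
  obtain ⟨κ, hκ, hev⟩ := exists_le_wordSum_bridgeWords hh.diff_invariant hℓ.lenMin_pos
    hℓ.iInf_le hfl hne hfφ hq hqφ hqv hs' htop
  refine le_liminf_rpow (K := ENNReal.ofReal (Real.exp (-(|s| * c))) * κ)
    (mul_ne_zero (ofReal_exp_ne_zero _) hκ) ?_
  filter_upwards [hev] with m hm
  rw [totalWeight_bridgeSet, ← ofReal_exp_nat_mul, mul_right_comm, ← ofReal_exp_add]
  set W := wordSum (fun γ => (φ γ : ℝ≥0∞))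
    {l | l ∈ bridgeWords h v ∧ (m : ℝ) ≤ wordLength ℓ l ∧ wordLength ℓ l < m + c}
  have hκW : κ ≤ ENNReal.ofReal (Real.exp (-(-(|s| * c) + m * s))) * W := by
    refine (hm.trans (wordSum_mono (Q := {l | l ∈ bridgeWords h v ∧ (m : ℝ) ≤ wordLength ℓ l ∧
      wordLength ℓ l < m + c}) ?_)).trans (wordSum_le_mul_wordSum ?_)
    · rintro l ⟨h₁, h₂, h₃⟩
      exact ⟨h₁, h₂, by linarith⟩
    · rintro l ⟨-, h₁, h₂⟩
      rw [wordWeight_tilt, mul_comm]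
      gcongr
      have := (abs_le.1 (mul_window_le (s := s) h₁ h₂)).1
      linarith
  calc _ ≤ ENNReal.ofReal (Real.exp (-(|s| * c) + m * s)) *
        (ENNReal.ofReal (Real.exp (-(-(|s| * c) + m * s))) * W) := by gcongr
    _ = W := by
      rw [← mul_assoc, ← ofReal_exp_add, add_neg_cancel]
      simp

lemma totalWeight_bridgeSet_le (m c : ℝ) (v : Γ) :
    totalWeight φ (bridgeSet h ℓ m c v) ≤ totalWeight φ (sawSet ℓ m c (1 : Γ)) := by
  rw [totalWeight_bridgeSet, totalWeight_sawSet]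
  exact wordSum_mono fun l hl => ⟨hl.1.1, hl.2⟩

lemma totalWeight_mono {ν : Γ → ℝ≥0} (hν : ν ≤ φ) {v : Γ} (P : Set (SAW v)) :
    totalWeight ν P ≤ totalWeight φ P := by
  refine ENNReal.tsum_le_tsum fun π => ENNReal.coe_le_coe.2 ?_
  exact List.prod_map_le_prod_map₀ _ _ (fun _ _ => zero_le) fun d _ => hν _

end Critical

end WeightedSAW

end

theorem theorem3p6 {Γ : Type*} [Group Γ] [Group.FG Γ]
    (H : Subgroup Γ) (F : H →* Multiplicative ℤ) (hF : WeightedSAW.IsVirtuallyIndicable H F)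
    (φ : Γ → ℝ≥0) (hφ : WeightedSAW.IsWeightFunction φ)
    (h : Γ → ℤ) (hh : WeightedSAW.IsStrongHeightFunction (WeightedSAW.supportGraph φ) h H)
    (C ε : ℝ) (hC : 0 < C) (hε : ε ∈ Set.Ico (1 : ℝ) 2)
    (ℓ : Γ → ℝ) (hℓ : WeightedSAW.IsHolderLength h φ C ε ℓ) :
    ∃ μ β : ℝ≥0∞,
      WeightedSAW.IsConnectiveConstant φ ℓ μ ∧
      WeightedSAW.IsBridgeConstant h φ ℓ β ∧
      0 < μ ∧ μ < ⊤ ∧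
      μ = β ∧
      (∀ᶠ c : ℝ in atTop,
        Tendsto (fun m : ℕ =>
          WeightedSAW.totalWeight φ (WeightedSAW.sawSet ℓ m c (1 : Γ)) ^ (1 / (m : ℝ)))
          atTop (𝓝 μ)) ∧
      ∀ ν : Γ → ℝ≥0, WeightedSAW.IsWeightFunction ν → ν ≤ φ →
        WeightedSAW.IsHolderLength h ν C ε ℓ ∧
        ∃ μν : ℝ≥0∞, WeightedSAW.IsConnectiveConstant ν ℓ μν ∧ μν ≤ μ := by
  have := hF.normal
  have := hF.finiteIndex
  have hℓ' := hℓ.toIsLengthFunction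
  obtain ⟨c₀, hc₀⟩ := WeightedSAW.exists_le_liminf_bridgeSet hφ hh hℓ'
  have hupper := WeightedSAW.limsup_sawSet_le hφ hh hℓ'
  have hle : ∀ (c : ℝ) (v : Γ) (m : ℕ),
      WeightedSAW.totalWeight φ (WeightedSAW.bridgeSet h ℓ m c v) ^ (1 / (m : ℝ)) ≤
        WeightedSAW.totalWeight φ (WeightedSAW.sawSet ℓ m c (1 : Γ)) ^ (1 / (m : ℝ)) :=
    fun c v m => ENNReal.rpow_le_rpow (WeightedSAW.totalWeight_bridgeSet_le _ _ _) (by positivity)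
  have hsaw : ∀ c ≥ c₀, Tendsto (fun m : ℕ =>
      WeightedSAW.totalWeight φ (WeightedSAW.sawSet ℓ m c (1 : Γ)) ^ (1 / (m : ℝ)))
      atTop (𝓝 (WeightedSAW.criticalValue H h φ ℓ)) := fun c hc =>
    tendsto_of_le_liminf_of_limsup_le
      ((hc₀ c hc 1).trans (liminf_le_liminf (Eventually.of_forall (hle c 1)))) (hupper c)
  refine ⟨WeightedSAW.criticalValue H h φ ℓ, WeightedSAW.criticalValue H h φ ℓ, ?_, ?_,
    pos_iff_ne_zero.2 (WeightedSAW.ofReal_exp_ne_zero _), ENNReal.ofReal_lt_top, rfl, ?_, ?_⟩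
  · filter_upwards [eventually_ge_atTop c₀] with c hc
    exact (hsaw c hc).limsup_eq
  · filter_upwards [eventually_ge_atTop c₀] with c hc v
    exact tendsto_of_le_liminf_of_limsup_le (hc₀ c hc v)
      ((limsup_le_limsup (Eventually.of_forall (hle c v))).trans (hupper c))
  · filter_upwards [eventually_ge_atTop c₀] with c hc
    exact hsaw c hc
  · intro ν _ hνφ
    refine ⟨⟨hℓ', fun u v huv => hℓ.holder u v (huv.trans_le (hνφ _))⟩,
      limsup (fun m : ℕ =>
        WeightedSAW.totalWeight ν (WeightedSAW.sawSet ℓ m 1 (1 : Γ)) ^ (1 / (m : ℝ))) atTop,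
      ?_, ?_⟩
    · filter_upwards [eventually_ge_atTop 1] with c hc
      exact WeightedSAW.limsup_window_eq ν ℓ hc
    -- The upper bound for `φ` holds at every width, in particular at width `1`, where the constant
    -- of `ν` is computed.
    · refine le_trans (limsup_le_limsup (Eventually.of_forall fun m => ?_)) (hupper 1)
      exact ENNReal.rpow_le_rpow (WeightedSAW.totalWeight_mono hνφ _) (by positivity)
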